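/- **Theorem 2.15.** Let $\mathcal{A}$ be an abelian category satisfying Ab4 (arbitrary set-indexed direct sums exist, and direct sums of exact sequences are exact), with derived category $D(\mathcal{A})$ of unbounded complexes. Regard $\mathcal{A}$ as a full subcategory of $D(\mathcal{A})$ through complexes concentrated in degree $0$. Let $d : P^{-1} \to P^{0}$ be a morphism in $\mathcal{A}$ between small projective objects ($M$ is small if $\operatorname{Hom}_{\mathcal{A}}(M,-)$ commutes with direct sums), and let $P^{\bullet}$ be the mapping cone of $d$, i.e. the complex $P^{-1}\to P^0$ in degrees $-1$ and $0$. Put $$\mathcal{X}(P^{\bullet}) = \{X \in \mathcal{A} : \operatorname{Hom}_{D(\mathcal{A})}(P^{\bullet}, X[1]) = 0\},\qquad \mathcal{Y}(P^{\bullet}) = \{X \in \mathcal{A} : \operatorname{Hom}_{D(\mathcal{A})}(P^{\bullet}, X) = 0\},$$ let $\mathcal{C}(P^{\bullet}) = D(\mathcal{A})^{0}(P^{\bullet})$ be the full subcategory of $D(\mathcal{A})$ of all $X^{\bullet}$ with $\operatorname{Hom}_{D(\mathcal{A})}(P^{\bullet}, X^{\bullet}[i]) = 0$ for every $i \neq 0$,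 and let $B = \operatorname{End}_{D(\mathcal{A})}(P^{\bullet})^{\mathrm{op}}$. Assume that $\mathcal{X}(P^{\bullet}) \cap \mathcal{Y}(P^{\bullet}) = \{0\}$ and $H^{0}(P^{\bullet}) \in \mathcal{X}(P^{\bullet})$. Then the following hold. 1. $\mathcal{C}(P^{\bullet})$ is admissible abelian: it is closed under finite direct sums, $\operatorname{Hom}_{D(\mathcal{A})}(X, Y[n]) = 0$ for all $X, Y \in \mathcal{C}(P^{\bullet})$ and $n < 0$, and for every morphism $f : X \to Y$ in $\mathcal{C}(P^{\bullet})$, completed to a distinguished triangle $X \xrightarrow{f} Y \to Z \to X[1]$ in $D(\mathcal{A})$, there are $K, Q \in \mathcal{C}(P^{\bullet})$ and a distinguished triangle $K[1] \to Z \to Q \to K[2]$. (Hence $\mathcal{C}(P^{\bullet})$ is an abelian category.) 2. For every $X \in \mathcal{C}(P^{\bullet})$ the class $\operatorname{Hom}_{D(\mathcal{A})}(P^{\bullet}, X)$ is a set, and the functor $\operatorname{Hom}_{D(\mathcal{A})}(P^{\bullet}, -) : \mathcal{C}(P^{\bullet}) \to \operatorname{Mod} B$ to the category of left $B$-modules is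 an equivalence. 3. $\mathcal{Y}(P^{\bullet})[1]$ and $\mathcal{X}(P^{\bullet})$ (closed under isomorphism in $D(\mathcal{A})$) are contained in $\mathcal{C}(P^{\bullet})$, and $(\mathcal{Y}(P^{\bullet})[1], \mathcal{X}(P^{\bullet}))$ is a torsion theory for the abelian category $\mathcal{C}(P^{\bullet})$: the intersection of the two subcategories is $\{0\}$; the first is closed under factor objects and the second under subobjects in $\mathcal{C}(P^{\bullet})$; and for every $Z \in \mathcal{C}(P^{\bullet})$ there is an exact sequence $0 \to Z' \to Z \to Z'' \to 0$ in $\mathcal{C}(P^{\bullet})$ with $Z' \in \mathcal{Y}(P^{\bullet})[1]$ and $Z'' \in \mathcal{X}(P^{\bullet})$. -/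

import Mathlib

open CategoryTheory CategoryTheory.Limits CategoryTheory.Pretriangulated

universe w v u

noncomputable section

namespace TwoTermHeart

/-! ### Admissible abelian subcategories and torsion theories -/

section Triangulated

variable {T : Type u} [Category.{v} T] [HasZeroObject T] [Preadditive T] [HasShift T ℤ]
  [∀ n : ℤ, (shiftFunctor T n).Additive] [Pretriangulated T]

/-- A full subcategory `S` of a triangulated category `T`, closed under finite direct sums, is
*admissible abelian* (Beilinson-Bernstein-Deligne) if `Hom (S, S[n]) = 0` for `n < 0` and every
morphism of `S` is `S`-admissible, i.e. its cone `Z` sits in a distinguished triangle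
`K[1] ⟶ Z ⟶ Q ⟶ K[1][1]` with `K` and `Q` in `S`. -/
structure IsAdmissibleAbelian (S : ObjectProperty T) : Prop where
  isClosedUnderFiniteProducts : S.IsClosedUnderFiniteProducts
  hom_shift_eq_zero : ∀ ⦃X Y : T⦄, S X → S Y → ∀ ⦃n : ℤ⦄, n < 0 → ∀ f : X ⟶ Y⟦n⟧, f = 0
  admissible : ∀ ⦃X Y : S.FullSubcategory⦄ (f : X ⟶ Y),
    Triangulated.AbelianSubcategory.admissibleMorphism S.ι f

/-- An admissible abelian subcategory is an abelian category (for the additive structure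
induced by the triangulated category). -/
@[reducible]
def IsAdmissibleAbelian.abelian [IsTriangulated T] {S : ObjectProperty T}
    (h : IsAdmissibleAbelian S) : Abelian S.FullSubcategory :=
  haveI := h.isClosedUnderFiniteProducts
  Triangulated.AbelianSubcategory.abelian S.ι
    (fun X Y _ f hn => h.hom_shift_eq_zero X.property Y.property hn f)
    (by ext X Y f; simpa using h.admissible f)

/-- The objects `X` with `Hom (C, X[i]) = 0` for all `i > n`. -/
def homLE (C : T) (n : ℤ) : ObjectProperty T :=
  fun X => ∀ i : ℤ, n < i → ∀ f : C ⟶ X⟦i⟧, f = 0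

/-- The objects `X` with `Hom (C, X[i]) = 0` for all `i < n`. -/
def homGE (C : T) (n : ℤ) : ObjectProperty T :=
  fun X => ∀ i : ℤ, i < n → ∀ f : C ⟶ X⟦i⟧, f = 0

/-- The objects `X` with `Hom (C, X[i]) = 0` for all `i ≠ 0`. -/
def heart (C : T) : ObjectProperty T := homLE C 0 ⊓ homGE C 0

end Triangulated

/-- A pair `(𝒳, 𝒴)` of full subcategories of an abelian category is a torsion theory if the
two subcategories meet exactly in the zero objects, `𝒳` is closed under factor objects, `𝒴` is
closed under subobjects, and every object `Z` is the middle term of a short exact sequence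
`0 ⟶ X' ⟶ Z ⟶ X'' ⟶ 0` with `X'` in `𝒳` and `X''` in `𝒴`. -/
structure IsTorsionTheory {𝒞 : Type u} [Category.{v} 𝒞] [Abelian 𝒞]
    (𝒳 𝒴 : ObjectProperty 𝒞) : Prop where
  inter_iff : ∀ Z : 𝒞, (𝒳 Z ∧ 𝒴 Z) ↔ IsZero Z
  isClosedUnderQuotients : 𝒳.IsClosedUnderQuotients
  isClosedUnderSubobjects : 𝒴.IsClosedUnderSubobjects
  exists_shortExact : ∀ Z : 𝒞, ∃ (X' X'' : 𝒞) (f : X' ⟶ Z) (g : Z ⟶ X'') (hfg : f ≫ g = 0),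
    (ShortComplex.mk f g hfg).ShortExact ∧ 𝒳 X' ∧ 𝒴 X''

/-! ### Two-term complexes of small projective objects -/

section Abelian

variable {A : Type u} [Category.{v} A] [Abelian A]

/-- An object `M` is small if `Hom (M, -)`, with values in abelian groups, commutes with direct
sums (indexed by sets, i.e. by types in the universe of the `Hom`-sets). -/
def IsSmallObject (M : A) : Prop :=
  ∀ J : Type v, PreservesColimitsOfShape (Discrete J) (preadditiveCoyoneda.obj (Opposite.op M))

variable [HasDerivedCategory.{w} A]

/-- The complex `P₁ ⟶ P₀` concentrated in degrees `-1` and `0`, as the mapping cone of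
`d : P₁ ⟶ P₀`, in the derived category. -/
def twoTerm {P₁ P₀ : A} (d : P₁ ⟶ P₀) : DerivedCategory A :=
  DerivedCategory.Q.obj
    (CochainComplex.mappingCone ((CochainComplex.singleFunctor A 0).map d))

/-- The objects `X` of `A` with `Hom (P, X[1]) = 0` in the derived category. -/
def torsionPart (P : DerivedCategory A) : ObjectProperty A :=
  fun X => ∀ f : P ⟶ ((DerivedCategory.singleFunctor A 0).obj X)⟦(1 : ℤ)⟧, f = 0

/-- The objects `X` of `A` with `Hom (P, X) = 0` in the derived category. -/
def torsionFreePart (P : DerivedCategory A) : ObjectProperty A :=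
  fun X => ∀ f : P ⟶ (DerivedCategory.singleFunctor A 0).obj X, f = 0

/-- A full subcategory of `A`, seen as a full subcategory of the derived category
(closed under isomorphisms) through complexes concentrated in degree `0`. -/
def inDegreeZero (𝒳 : ObjectProperty A) : ObjectProperty (DerivedCategory A) :=
  𝒳.map (DerivedCategory.singleFunctor A 0)

/-- The translate `𝒴[1]` of a full subcategory `𝒴` of `A` inside the derived category
(closed under isomorphisms). -/
def inDegreeZeroShift (𝒴 : ObjectProperty A) : ObjectProperty (DerivedCategory A) :=
  𝒴.map (DerivedCategory.singleFunctor A 0 ⋙ shiftFunctor (DerivedCategory A) (1 : ℤ))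

end Abelian

/-! ### Modules and the functor `Hom (C, -)` -/

/-- The category `Mod B` of all left `B`-modules whose underlying type is a set, i.e. is in
bijection with a type in `Type v`. When `w = v` this is all of `ModuleCat.{v} B`. The universe `w`
is allowed to differ from `v` because the `Hom`-types of a derived category need not a priori
lie in the same universe as those of the abelian category. -/
def setModules (B : Type w) [Ring B] : ObjectProperty (ModuleCat.{w} B) :=
  fun M => Small.{v} M

/-- The functor `Hom (C, -)` on a full subcategory `S`, with values in left modules over
the ring `B = (End C)ᵐᵒᵖ`. Since the product of `End C` is composition of maps
(`f * g = f ∘ g`), `b` in `B` acts on `φ : C ⟶ X` as `b • φ = φ ∘ b`. -/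
def homFunctor {T : Type u} [Category.{w} T] [Preadditive T] (C : T) (S : ObjectProperty T) :
    S.FullSubcategory ⥤ ModuleCat.{w} (End C)ᵐᵒᵖ :=
  S.ι ⋙ preadditiveCoyonedaObj C

end TwoTermHeart

end

namespace TwoTermHeart

open DerivedCategory TStructure ZeroObject

/-! Applying Hom to the triangle `P₁ ⟶ P₀ ⟶ P ⟶ P₁[1]` turns both conditions on an object `X` of `A`
into statements about `Hom(P₀, X) ⟶ Hom(P₁, X)`: its cokernel is `Hom(P, X[1])` and its kernel is
`Hom(P, X)`. So `torsionPart P` is closed under quotients and, `P₁` being small, under coproducts,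
while `torsionFreePart P` is closed under subobjects. Since the two meet in zero, there are no
nonzero maps from the first to the second, and the trace of `H⁰(P)` in an object is a torsion
subobject with torsion-free quotient (`exists_torsion_shortExact`).

Tilting the standard t-structure along this torsion theory gives, for each `Z`, a triangle `U ⟶ Z ⟶
V` with `U` in `homLE P 0` and `V` in `homGE P 1` (`exists_tilted_triangle`). An object with no maps
from any shift of `P` is zero (`isZero_of_homVanish`), so the tilted halves are exactly `homLE P 0`
and `homGE P 1`. Thus `heart P` is the heart of a t-structure. This gives admissibility, and the
cohomology of an object of the heart, which lies in degrees `-1` and `0`, gives its torsion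
sequence.

For the equivalence with modules, the cone of the coproduct of copies of `d` is a coproduct of
copies of `P` in the derived category. Smallness makes every map from `P` to it finitely supported,
and its truncation is an object of the heart corresponding to a free module (`exists_free_object`).
Faithfulness, fullness and essential surjectivity of `Hom(P, -)` then follow from free
presentations. -/

lemma eq_zero_of_iso {T : Type u} [Category.{v} T] [HasZeroMorphisms T]
    {X X' Y Y' : T} (e : X ≅ X') (e' : Y ≅ Y') (h : ∀ f : X ⟶ Y, f = 0)
    (f : X' ⟶ Y') : f = 0 := by
  have := h (e.hom ≫ f ≫ e'.inv)
  rw [← cancel_epi e.hom, ← cancel_mono e'.inv]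
  simpa using this

/-! ### Vanishing of Hom groups along distinguished triangles. -/

section Vanishing

variable {T : Type u} [Category.{v} T] [Preadditive T] [HasShift T ℤ]

/-- All morphisms `X ⟶ Y[n]` vanish. -/
def HomVanish (X Y : T) (n : ℤ) : Prop := ∀ f : X ⟶ Y⟦n⟧, f = 0

lemma HomVanish.of_iso {X Y Y' : T} {n : ℤ} (h : HomVanish X Y n) (e : Y ≅ Y') :
    HomVanish X Y' n :=
  eq_zero_of_iso (Iso.refl X) ((shiftFunctor T n).mapIso e) h

lemma homVanish_shift_iff {X Y : T} (a n m : ℤ) (h : a + n = m) :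
    HomVanish X (Y⟦a⟧) n ↔ HomVanish X Y m :=
  ⟨eq_zero_of_iso (Iso.refl X) ((shiftFunctorAdd' T a n m h).symm.app Y),
    eq_zero_of_iso (Iso.refl X) ((shiftFunctorAdd' T a n m h).app Y)⟩

lemma homVanish_zero_iff {X Y : T} : HomVanish X Y 0 ↔ ∀ f : X ⟶ Y, f = 0 :=
  ⟨eq_zero_of_iso (Iso.refl X) ((shiftFunctorZero T ℤ).app Y),
    eq_zero_of_iso (Iso.refl X) ((shiftFunctorZero T ℤ).symm.app Y)⟩

variable [∀ n : ℤ, (shiftFunctor T n).Additive]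

lemma eq_zero_shift_iff {X Y : T} (n m : ℤ) (h : n + m = 0) :
    (∀ f : X⟦n⟧ ⟶ Y, f = 0) ↔ HomVanish X Y m := by
  constructor
  · intro hf f
    apply (shiftFunctor T n).map_injective
    rw [Functor.map_zero]
    exact eq_zero_of_iso (Iso.refl _)
      ((shiftFunctorZero T ℤ).symm.app Y ≪≫ (shiftFunctorAdd' T m n 0 (by lia)).app Y) hf _
  · intro hf f
    apply (shiftFunctor T m).map_injective
    rw [Functor.map_zero]
    exact eq_zero_of_iso
      ((shiftFunctorZero T ℤ).symm.app X ≪≫ (shiftFunctorAdd' T n m 0 h).app X) (Iso.refl _) hf _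

section

variable [HasZeroObject T] [Pretriangulated T] {A B C : T} {f : A ⟶ B} {g : B ⟶ C} {k : C ⟶ A⟦(1 : ℤ)⟧}
  (h : Triangle.mk f g k ∈ distTriang T)
include h

lemma exists_lift_mor₁ {X : T} (u : X ⟶ B) (hu : u ≫ g = 0) : ∃ l : X ⟶ A, u = l ≫ f :=
  Triangle.coyoneda_exact₂ _ h u hu

lemma exists_lift_mor₂ {X : T} (u : X ⟶ C) (hu : u ≫ k = 0) : ∃ l : X ⟶ B, u = l ≫ g :=
  Triangle.coyoneda_exact₃ _ h u hu

lemma exists_desc_mor₂ {X : T} (u : B ⟶ X) (hu : f ≫ u = 0) : ∃ l : C ⟶ X, u = g ≫ l :=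
  Triangle.yoneda_exact₂ _ h u hu

lemma exists_desc_mor₃ {X : T} (u : C ⟶ X) (hu : g ≫ u = 0) :
    ∃ l : A⟦(1 : ℤ)⟧ ⟶ X, u = k ≫ l :=
  Triangle.yoneda_exact₃ _ h u hu

lemma exists_desc_shift_mor₁ {X : T} (u : A⟦(1 : ℤ)⟧ ⟶ X) (hu : k ≫ u = 0) :
    ∃ l : B⟦(1 : ℤ)⟧ ⟶ X, u = f⟦(1 : ℤ)⟧' ≫ l := by
  obtain ⟨l, hl⟩ : ∃ l : B⟦(1 : ℤ)⟧ ⟶ X, u = (-f⟦(1 : ℤ)⟧') ≫ l :=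
    Triangle.yoneda_exact₃ _ (rot_of_distTriang _ h) u hu
  exact ⟨-l, by rw [hl, Preadditive.comp_neg, Preadditive.neg_comp]⟩

lemma mor₁_comp_mor₂ : f ≫ g = 0 := comp_distTriang_mor_zero₁₂ _ h
lemma mor₂_comp_mor₃ : g ≫ k = 0 := comp_distTriang_mor_zero₂₃ _ h
lemma mor₃_comp_mor₁ : k ≫ f⟦(1 : ℤ)⟧' = 0 := comp_distTriang_mor_zero₃₁ _ h

lemma distTriang_of_iso₃ {C' : T} (e : C ≅ C') :
    Triangle.mk f (g ≫ e.hom) (e.inv ≫ k) ∈ distTriang T :=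
  isomorphic_distinguished _ h _ (Triangle.isoMk (Triangle.mk f (g ≫ e.hom) (e.inv ≫ k))
    (Triangle.mk f g k) (Iso.refl _) (Iso.refl _) e.symm
    (show f ≫ 𝟙 _ = 𝟙 _ ≫ f by simp) (show (g ≫ e.hom) ≫ e.inv = 𝟙 _ ≫ g by simp)
    (show (e.inv ≫ k) ≫ (𝟙 A)⟦(1 : ℤ)⟧' = e.inv ≫ k by simp))

lemma distTriang_of_iso₁ {A' : T} (e : A ≅ A') :
    Triangle.mk (e.inv ≫ f) g (k ≫ e.hom⟦(1 : ℤ)⟧') ∈ distTriang T :=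
  isomorphic_distinguished _ h _ (Triangle.isoMk
    (Triangle.mk (e.inv ≫ f) g (k ≫ e.hom⟦(1 : ℤ)⟧'))
    (Triangle.mk f g k) e.symm (Iso.refl _) (Iso.refl _)
    (show (e.inv ≫ f) ≫ 𝟙 _ = e.inv ≫ f by simp) (show g ≫ 𝟙 _ = 𝟙 _ ≫ g by simp)
    (show (k ≫ e.hom⟦(1 : ℤ)⟧') ≫ e.inv⟦(1 : ℤ)⟧' = 𝟙 _ ≫ k by
      rw [Category.assoc, ← Functor.map_comp, e.hom_inv_id]; simp))

lemma distTriang_of_iso₂ {B' : T} (e : B ≅ B') :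
    Triangle.mk (f ≫ e.hom) (e.inv ≫ g) k ∈ distTriang T :=
  isomorphic_distinguished _ h _ (Triangle.isoMk (Triangle.mk (f ≫ e.hom) (e.inv ≫ g) k)
    (Triangle.mk f g k) (Iso.refl _) e.symm (Iso.refl _)
    (show (f ≫ e.hom) ≫ e.inv = 𝟙 _ ≫ f by simp) (show (e.inv ≫ g) ≫ 𝟙 _ = e.inv ≫ g by simp)
    (show k ≫ (𝟙 A)⟦(1 : ℤ)⟧' = 𝟙 _ ≫ k by simp))

lemma eq_zero_from_mor₂ {X : T} (h₁ : ∀ u : A ⟶ X, u = 0) (h₃ : ∀ u : C ⟶ X, u = 0)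
    (u : B ⟶ X) : u = 0 := by
  obtain ⟨l, rfl⟩ := exists_desc_mor₂ h u (h₁ _)
  rw [h₃ l, comp_zero]

lemma eq_zero_from_mor₃ {X : T} (h₂ : ∀ u : B ⟶ X, u = 0) (h₁ : ∀ u : A⟦(1 : ℤ)⟧ ⟶ X, u = 0)
    (u : C ⟶ X) : u = 0 := by
  obtain ⟨l, rfl⟩ := exists_desc_mor₃ h u (h₂ _)
  rw [h₁ l, comp_zero]

lemma eq_zero_to_mor₂ {X : T} (h₁ : ∀ u : X ⟶ A, u = 0) (h₃ : ∀ u : X ⟶ C, u = 0)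
    (u : X ⟶ B) : u = 0 := by
  obtain ⟨l, rfl⟩ := exists_lift_mor₁ h u (h₃ _)
  rw [h₁ l, zero_comp]

lemma homVanish_mor₂ {X : T} (n : ℤ) (h₁ : HomVanish X A n) (h₃ : HomVanish X C n) :
    HomVanish X B n :=
  eq_zero_to_mor₂ (Triangle.shift_distinguished _ h n) h₁ h₃

lemma homVanish_mor₃ {X : T} (n m : ℤ) (hm : n + 1 = m) (h₂ : HomVanish X B n)
    (h₁ : HomVanish X A m) : HomVanish X C n :=
  homVanish_mor₂ (rot_of_distTriang _ h) n h₂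
    ((homVanish_shift_iff 1 n m (by lia)).2 h₁)

lemma homVanish_mor₁ {X : T} (n m : ℤ) (hm : n + 1 = m) (h₃ : HomVanish X C n)
    (h₂ : HomVanish X B m) : HomVanish X A m :=
  homVanish_mor₂ (inv_rot_of_distTriang _ h) m
    ((homVanish_shift_iff (-1) m n (by lia)).2 h₃) h₂

omit h in
-- Three inverse rotations shift a triangle by `-1` up to signs. Only the existence of some triangle
-- on these vertices is needed, so the morphisms are left unspecified.
lemma exists_distTriang_of_shift {B' : T} {f' : A⟦(1 : ℤ)⟧ ⟶ B'} {g' : B' ⟶ C⟦(1 : ℤ)⟧}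
    {k' : C⟦(1 : ℤ)⟧ ⟶ A⟦(1 : ℤ)⟧⟦(1 : ℤ)⟧} (h' : Triangle.mk f' g' k' ∈ distTriang T) :
    ∃ (f : A ⟶ B'⟦(-1 : ℤ)⟧) (g : B'⟦(-1 : ℤ)⟧ ⟶ C) (k : C ⟶ A⟦(1 : ℤ)⟧),
      Triangle.mk f g k ∈ distTriang T :=
  ⟨_, _, _, distTriang_of_iso₃ (distTriang_of_iso₁
    (inv_rot_of_distTriang _ (inv_rot_of_distTriang _ (inv_rot_of_distTriang _ h')))
      ((shiftEquiv T (1 : ℤ)).unitIso.symm.app A)) ((shiftEquiv T (1 : ℤ)).unitIso.symm.app C)⟩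

lemma eq_zero_of_comp_mor₁ {X : T} (h₃ : HomVanish X C (-1)) (u : X ⟶ A) (hu : u ≫ f = 0) :
    u = 0 := by
  obtain ⟨m, l, rfl⟩ : ∃ (m : C⟦(-1 : ℤ)⟧ ⟶ A) (l : X ⟶ C⟦(-1 : ℤ)⟧), u = l ≫ m :=
    ⟨_, Triangle.coyoneda_exact₂ _ (inv_rot_of_distTriang _ h) u hu⟩
  rw [h₃ l, zero_comp]

end

end Vanishing

/-! ### Behaviour of `homLE` and `homGE` under shifts and triangles. -/

section HomBounds

variable {T : Type u} [Category.{v} T] [Preadditive T] [HasShift T ℤ] {P : T}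

lemma homLE_shift {X : T} {n : ℤ} (h : homLE P n X) (a m : ℤ) (ha : n ≤ a + m) :
    homLE P m (X⟦a⟧) :=
  fun i hi => (homVanish_shift_iff a i _ rfl).2 (h _ (by lia))

lemma homGE_shift {X : T} {n : ℤ} (h : homGE P n X) (a m : ℤ) (ha : a + m ≤ n) :
    homGE P m (X⟦a⟧) :=
  fun i hi => (homVanish_shift_iff a i _ rfl).2 (h _ (by lia))

lemma homLE_of_iso {X Y : T} {n : ℤ} (h : homLE P n X) (e : X ≅ Y) : homLE P n Y :=
  fun i hi => HomVanish.of_iso (h i hi) e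

lemma homGE_of_iso {X Y : T} {n : ℤ} (h : homGE P n X) (e : X ≅ Y) : homGE P n Y :=
  fun i hi => HomVanish.of_iso (h i hi) e

lemma heart_of_iso {X Y : T} (h : heart P X) (e : X ≅ Y) : heart P Y :=
  ⟨homLE_of_iso h.1 e, homGE_of_iso h.2 e⟩

variable [HasZeroObject T] [∀ n : ℤ, (shiftFunctor T n).Additive] [Pretriangulated T]
  {A B C : T} {f : A ⟶ B} {g : B ⟶ C} {k : C ⟶ A⟦(1 : ℤ)⟧}
  (h : Triangle.mk f g k ∈ distTriang T)
include h

lemma homLE_mor₂ {n : ℤ} (h₁ : homLE P n A) (h₃ : homLE P n C) : homLE P n B :=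
  fun i hi => homVanish_mor₂ h i (h₁ i hi) (h₃ i hi)

lemma homGE_mor₂ {n : ℤ} (h₁ : homGE P n A) (h₃ : homGE P n C) : homGE P n B :=
  fun i hi => homVanish_mor₂ h i (h₁ i hi) (h₃ i hi)

lemma homLE_mor₃ {n : ℤ} (h₂ : homLE P n B) (h₁ : homLE P (n + 1) A) : homLE P n C :=
  fun i hi => homVanish_mor₃ h i _ rfl (h₂ i hi) (h₁ _ (by lia))

lemma homGE_mor₃ {n : ℤ} (h₂ : homGE P n B) (h₁ : homGE P (n + 1) A) : homGE P n C :=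
  fun i hi => homVanish_mor₃ h i _ rfl (h₂ i hi) (h₁ _ (by lia))

end HomBounds

/-! ### Maps in the derived category out of projective objects. -/

section Projective

variable {A : Type u} [Category.{v} A] [Abelian A]

lemma isKProjective_single (Q : A) [Projective Q] :
    CochainComplex.IsKProjective ((HomologicalComplex.single A (ComplexShape.up ℤ) 0).obj Q) := by
  have (n : ℤ) :
      Projective (((HomologicalComplex.single A (ComplexShape.up ℤ) 0).obj Q).X n) := by
    by_cases hn : n = 0
    · subst hn
      exact Projective.of_iso (HomologicalComplex.singleObjXSelf _ 0 Q).symm inferInstance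
    · exact Projective.of_iso (HomologicalComplex.isZero_single_obj_X _ 0 Q n hn).isoZero.symm
        inferInstance
  exact CochainComplex.isKProjective_of_projective _ 0

variable [HasDerivedCategory.{w} A]

/-- A projective object in degree `0` is a K-projective complex, so `f` comes from a chain map, here
into a complex that is zero in degree `0`. -/
lemma eq_zero_of_projective_of_isLE (Q : A) [Projective Q] (V : DerivedCategory A)
    (hV : V.IsLE (-1)) (f : (singleFunctor A 0).obj Q ⟶ V) : f = 0 := by
  obtain ⟨K, _, ⟨e⟩⟩ := V.exists_iso_Q_obj_of_isLE (-1)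
  refine eq_zero_of_iso (Iso.refl _) e.symm (fun f => ?_) f
  have := isKProjective_single Q
  let X := (HomologicalComplex.single A (ComplexShape.up ℤ) 0).obj Q
  obtain ⟨g, hg⟩ := (CochainComplex.IsKProjective.Qh_map_bijective X
    ((HomotopyCategory.quotient _ _).obj K)).2
      ((quotientCompQhIso A).hom.app X ≫ f ≫ (quotientCompQhIso A).inv.app K)
  obtain ⟨φ, rfl⟩ := (HomotopyCategory.quotient _ _).map_surjective g
  obtain rfl : φ = 0 :=
    HomologicalComplex.from_single_hom_ext ((K.isZero_of_isStrictlyLE (-1) 0).eq_of_tgt _ _)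
  rw [Functor.map_zero, Functor.map_zero] at hg
  have hg' := (quotientCompQhIso A).inv.app X ≫= hg
  rw [comp_zero, Iso.inv_hom_id_app_assoc] at hg'
  exact (cancel_mono ((quotientCompQhIso A).inv.app K)).1 (hg'.symm.trans zero_comp.symm)

lemma homVanish_of_projective_of_isLE (Q : A) [Projective Q] {V : DerivedCategory A} (n m : ℤ)
    (hV : V.IsLE n) (h : n < m) : HomVanish ((singleFunctor A 0).obj Q) V m := by
  have := t.isLE_shift V n m (n - m)
  exact eq_zero_of_projective_of_isLE Q _ (t.isLE_of_le _ (n - m) (-1))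

/-- Morphisms from projective objects (in degree `0`) to an object `V` of the derived category
are represented by an object of the abelian category. -/
lemma exists_equiv_of_projective (V : DerivedCategory A) :
    ∃ (Y : A) (e : ∀ (Q : A) [Projective Q], ((singleFunctor A 0).obj Q ⟶ V) ≃ (Q ⟶ Y)),
      (∀ (Q Q' : A) [Projective Q] [Projective Q'] (q : Q ⟶ Q')
        (f : (singleFunctor A 0).obj Q' ⟶ V),
        e Q ((singleFunctor A 0).map q ≫ f) = q ≫ e Q' f) ∧
      (IsZero Y → IsZero ((homologyFunctor A 0).obj V)) := by
  -- Two truncations cut out the degree `0` cohomology `X` of `V`: neither `N`, in degrees `≤ -1`,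
  -- nor `E`, in degrees `≥ 1`, affects maps from a projective object in degree `0`.
  obtain ⟨N, W, hN, hW, i, p, k, h⟩ := t.exists_triangle V (-1) 0 (by lia)
  obtain ⟨X, E, hX, hE, j, q, l, h'⟩ := t.exists_triangle W 0 1 (by lia)
  have : N.IsLE (-1) := ⟨hN⟩
  have : W.IsGE 0 := ⟨hW⟩
  have : X.IsLE 0 := ⟨hX⟩
  have : E.IsGE 1 := ⟨hE⟩
  have : X.IsGE 0 := by
    have := t.isGE_shift E 1 (-1) 2
    exact t.isGE₂ _ (inv_rot_of_distTriang _ h') 0 (t.isGE_of_ge (E⟦(-1 : ℤ)⟧) 0 2) ‹_›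
  obtain ⟨Y, ⟨ε⟩⟩ := exists_iso_singleFunctor_obj_of_isGE_of_isLE X 0
  have hp (Q : A) [Projective Q] :
      Function.Bijective (fun f : (singleFunctor A 0).obj Q ⟶ V => f ≫ p) := by
    constructor
    · intro f g hfg
      obtain ⟨r, hr⟩ := exists_lift_mor₁ h (f - g)
        (by rw [Preadditive.sub_comp]; exact sub_eq_zero.2 hfg)
      rw [eq_zero_of_projective_of_isLE Q _ ‹_› r, zero_comp] at hr
      exact sub_eq_zero.1 hr
    · intro f
      obtain ⟨r, hr⟩ := exists_lift_mor₂ h f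
        (homVanish_of_projective_of_isLE Q (-1) 1 ‹_› (by lia) _)
      exact ⟨r, hr.symm⟩
  have hj (Q : A) [Projective Q] :
      Function.Bijective (fun f : (singleFunctor A 0).obj Q ⟶ X => f ≫ j) := by
    constructor
    · intro f g hfg
      have := t.isGE_shift E 1 (-1) 2
      exact sub_eq_zero.1 (eq_zero_of_comp_mor₁ h' (fun r => t.zero r 0 2) (f - g)
        (by rw [Preadditive.sub_comp]; exact sub_eq_zero.2 hfg))
    · intro f
      obtain ⟨r, hr⟩ := exists_lift_mor₁ h' f (t.zero _ 0 1)
      exact ⟨r, hr.symm⟩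
  have hs (Q : A) : Function.Bijective
      (fun f : Q ⟶ Y => (singleFunctor A 0).map f ≫ ε.inv) := by
    constructor
    · intro f g hfg
      exact (singleFunctor A 0).map_injective ((cancel_mono ε.inv).1 hfg)
    · intro f
      obtain ⟨g, hg⟩ := (singleFunctor A 0).map_surjective (f ≫ ε.hom)
      exact ⟨g, by simp [hg]⟩
  refine ⟨Y, fun Q _ => (Equiv.ofBijective _ (hp Q)).trans
    ((Equiv.ofBijective _ ((hj Q).comp (hs Q))).symm), ?_, ?_⟩
  · intro Q Q' _ _ q f
    obtain ⟨y, hy⟩ := ((hj Q').comp (hs Q')).2 (f ≫ p)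
    have hy' : (Equiv.ofBijective _ ((hj Q').comp (hs Q'))).symm (f ≫ p) = y := by
      rw [Equiv.symm_apply_eq]
      exact hy.symm
    rw [Equiv.trans_apply, Equiv.trans_apply, Equiv.symm_apply_eq, Equiv.ofBijective_apply,
      Equiv.ofBijective_apply, Equiv.ofBijective_apply, hy']
    dsimp at hy ⊢
    rw [Functor.map_comp, Category.assoc, Category.assoc, Category.assoc, ← hy, Category.assoc]
  · intro hY
    have hX' : IsZero X := ((singleFunctor A 0).map_isZero hY).of_iso ε
    have hq : IsIso q := (Triangle.isZero₁_iff_isIso₂ _ h').1 hX'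
    have h₁ := HomologySequence.exact₂ _ h 0
    refine h₁.isZero_of_both_zeros ?_ ?_
    · exact (isZero_of_isLE N (-1) 0 (by lia)).eq_of_src _ _
    · refine IsZero.eq_of_tgt ?_ _ _
      exact (isZero_of_isGE E 1 0 (by lia)).of_iso
        ((homologyFunctor A 0).mapIso (@asIso _ _ _ _ q hq))

end Projective

/-! ### Maps from a small object to a coproduct. -/

section Small

variable {A : Type u} [Category.{v} A] [Abelian A]

lemma IsSmallObject.hom_induction {M : A} (hM : IsSmallObject M) {J : Type v} (X : J → A)
    [HasCoproduct X] {p : (M ⟶ ∐ X) → Prop} (hι : ∀ (j : J) (g : M ⟶ X j), p (g ≫ Sigma.ι X j))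
    (zero : p 0) (add : ∀ f g, p f → p g → p (f + g)) (f : M ⟶ ∐ X) : p f := by
  have := hM J
  let F := preadditiveCoyoneda.obj (Opposite.op M)
  let hc : IsColimit (Cofan.mk (F.obj (∐ X)) fun j => F.map (Sigma.ι X j)) :=
    isColimitCofanMkObjOfIsColimit F X _ (coproductIsCoproduct X)
  let S : J → AddSubgroup (M ⟶ ∐ X) := fun j => (F.map (Sigma.ι X j)).hom.range
  have hS : ∀ f : M ⟶ ∐ X, f ∈ ⨆ j, S j := by
    intro f
    -- The quotient by the subgroup generated by the maps through one summand is killed on each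
    -- summand of the coproduct `F.obj (∐ X)`, hence is zero.
    let q : F.obj (∐ X) ⟶ AddCommGrpCat.of ((M ⟶ ∐ X) ⧸ ⨆ j, S j) :=
      AddCommGrpCat.ofHom (QuotientAddGroup.mk' (⨆ j, S j))
    have hq : q = 0 := by
      refine Cofan.IsColimit.hom_ext hc _ _ fun j => ?_
      ext g
      refine (QuotientAddGroup.eq_zero_iff _).2 ?_
      exact AddSubgroup.mem_iSup_of_mem j ⟨g, rfl⟩
    have := ConcreteCategory.congr_hom hq f
    exact (QuotientAddGroup.eq_zero_iff _).1 this
  refine AddSubgroup.iSup_induction S (C := p) (hS f) ?_ zero add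
  rintro j _ ⟨g, rfl⟩
  exact hι j g

end Small

/-! ### The torsion theory of `A` defined by a two-term complex. -/

section TwoTerm

variable {A : Type u} [Category.{v} A] [Abelian A] [HasDerivedCategory.{w} A]
  {P₁ P₀ : A} [Projective P₁] [Projective P₀] {d : P₁ ⟶ P₀} {P : DerivedCategory A}
  {a : (singleFunctor A 0).obj P₀ ⟶ P} {b : P ⟶ ((singleFunctor A 0).obj P₁)⟦(1 : ℤ)⟧}
  (hT : Triangle.mk ((singleFunctor A 0).map d) a b ∈ distTriang (DerivedCategory A))

lemma isLE_single_shift (X : A) : (((singleFunctor A 0).obj X)⟦(1 : ℤ)⟧).IsLE (-1) :=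
  t.isLE_shift _ 0 1 (-1)

omit [Projective P₁] [Projective P₀] in
include hT in
lemma isLE_of_twoTerm : P.IsLE 0 := by
  have := isLE_single_shift.{w} P₁
  exact t.isLE₂ _ (rot_of_distTriang _ hT) 0 (inferInstanceAs (((singleFunctor A 0).obj P₀).IsLE 0))
    (t.isLE_of_le (((singleFunctor A 0).obj P₁)⟦(1 : ℤ)⟧) (-1) 0)

omit [Projective P₁] [Projective P₀] in
include hT in
lemma homVanish_of_isGE {V : DerivedCategory A} (n m : ℤ) (hV : V.IsGE n) (h : m < n) :
    HomVanish P V m := by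
  have := isLE_of_twoTerm hT
  have := t.isGE_shift V n m (n - m)
  exact fun f => t.zero f 0 (n - m)

include hT in
-- The bound is `n + 1 < m`, one worse than for a projective object, because `P₁` sits in degree
-- `-1`.
lemma homVanish_of_isLE {V : DerivedCategory A} (n m : ℤ) (hV : V.IsLE n) (h : n + 1 < m) :
    HomVanish P V m := by
  refine eq_zero_from_mor₃ hT (homVanish_of_projective_of_isLE P₀ n m hV (by lia)) ?_
  rw [eq_zero_shift_iff 1 (-1) (by lia), homVanish_shift_iff m (-1) (m - 1) (by lia)]
  exact homVanish_of_projective_of_isLE P₁ n (m - 1) hV (by lia)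

omit [Projective P₁] [Projective P₀] in
include hT in
lemma homGE_of_isGE {V : DerivedCategory A} (n : ℤ) (hV : V.IsGE n) : homGE P n V :=
  fun i hi => homVanish_of_isGE hT n i hV hi

include hT in
lemma homLE_of_isLE {V : DerivedCategory A} (n : ℤ) (hV : V.IsLE (n - 1)) : homLE P n V :=
  fun i hi => homVanish_of_isLE hT (n - 1) i hV (by lia)

omit [Projective P₁] in
include hT in
-- `Hom(P₀, X[1]) = 0` by projectivity, so `Hom(P, X[1])` is the cokernel of composition with `d`.
lemma torsionPart_iff (X : A) :
    torsionPart P X ↔ ∀ g : P₁ ⟶ X, ∃ h : P₀ ⟶ X, d ≫ h = g := by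
  constructor
  · intro hX g
    obtain ⟨l, hl⟩ := exists_desc_shift_mor₁ hT (((singleFunctor A 0).map g)⟦(1 : ℤ)⟧') (hX _)
    obtain ⟨l, rfl⟩ := (shiftFunctor (DerivedCategory A) (1 : ℤ)).map_surjective l
    obtain ⟨h, rfl⟩ := (singleFunctor A 0).map_surjective l
    rw [← Functor.map_comp, ← Functor.map_comp] at hl
    exact ⟨h, ((singleFunctor A 0).map_injective
      ((shiftFunctor (DerivedCategory A) (1 : ℤ)).map_injective hl)).symm⟩
  · intro hX f
    obtain ⟨l, rfl⟩ := exists_desc_mor₃ hT f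
      (homVanish_of_projective_of_isLE P₀ 0 1 inferInstance (by lia) _)
    obtain ⟨l, rfl⟩ := (shiftFunctor (DerivedCategory A) (1 : ℤ)).map_surjective l
    obtain ⟨g, rfl⟩ := (singleFunctor A 0).map_surjective l
    obtain ⟨h, rfl⟩ := hX g
    rw [Functor.map_comp, Functor.map_comp, reassoc_of% (mor₃_comp_mor₁ hT), zero_comp]

omit [Projective P₁] [Projective P₀] in
include hT in
-- `Hom(P₁[1], X) = 0` for degree reasons, so `Hom(P, X)` is the kernel of composition with `d`.
lemma torsionFreePart_iff (X : A) :
    torsionFreePart P X ↔ ∀ u : P₀ ⟶ X, d ≫ u = 0 → u = 0 := by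
  constructor
  · intro hX u hu
    obtain ⟨l, hl⟩ := exists_desc_mor₂ hT ((singleFunctor A 0).map u)
      (by rw [← Functor.map_comp, hu, Functor.map_zero])
    rw [hX l, comp_zero] at hl
    exact (singleFunctor A 0).map_injective (hl.trans (Functor.map_zero _ _ _).symm)
  · intro hX f
    obtain ⟨u, hu⟩ := (singleFunctor A 0).map_surjective (a ≫ f)
    have hu' : u = 0 := hX u ((singleFunctor A 0).map_injective (by
      rw [Functor.map_comp, hu, reassoc_of% (mor₁_comp_mor₂ hT), zero_comp, Functor.map_zero]))
    rw [hu', Functor.map_zero] at hu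
    obtain ⟨l, rfl⟩ := exists_desc_mor₃ hT f hu.symm
    have := isLE_single_shift.{w} P₁
    rw [t.zero l (-1) 0, comp_zero]

omit [Projective P₁] [Projective P₀] in
lemma torsionPart_of_iso {X Y : A} (h : torsionPart P X) (e : X ≅ Y) : torsionPart P Y :=
  HomVanish.of_iso (n := 1) h ((singleFunctor A 0).mapIso e)

include hT in
lemma homLE_of_torsionPart {X : A} (h : torsionPart P X) :
    homLE P 0 ((singleFunctor A 0).obj X) := by
  intro i hi
  obtain rfl | hi : i = 1 ∨ 1 < i := by lia
  · exact h
  · exact homVanish_of_isLE hT 0 i inferInstance (by lia)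

omit [Projective P₁] [Projective P₀] in
include hT in
lemma homGE_of_torsionFreePart {X : A} (h : torsionFreePart P X) :
    homGE P 1 ((singleFunctor A 0).obj X) := by
  intro i hi
  obtain rfl | hi : i = 0 ∨ i < 0 := by lia
  · exact homVanish_zero_iff.2 h
  · exact homVanish_of_isGE hT 0 i inferInstance hi

omit [Projective P₁] [Projective P₀] in
include hT in
/-- If `H⁰(P)` is torsion, the truncation `P ⟶ τ≥0 P` has a torsion target. -/
lemma exists_truncation_twoTerm (h_H0 : torsionPart P ((homologyFunctor A 0).obj P)) :
    ∃ (N : DerivedCategory A) (Y : A) (i : N ⟶ P) (p : P ⟶ (singleFunctor A 0).obj Y)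
      (k : (singleFunctor A 0).obj Y ⟶ N⟦(1 : ℤ)⟧),
      Triangle.mk i p k ∈ distTriang (DerivedCategory A) ∧ N.IsLE (-1) ∧ torsionPart P Y := by
  have := isLE_of_twoTerm hT
  obtain ⟨N, W, hN, hW, i, p, k, h⟩ := t.exists_triangle P (-1) 0 (by lia)
  have : N.IsLE (-1) := ⟨hN⟩
  have : W.IsGE 0 := ⟨hW⟩
  have : W.IsLE 0 := by
    have := t.isLE_shift N (-1) 1 (-2)
    exact t.isLE₂ _ (rot_of_distTriang _ h) 0 ‹_› (t.isLE_of_le (N⟦(1 : ℤ)⟧) (-2) 0)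
  obtain ⟨Y, ⟨e⟩⟩ := exists_iso_singleFunctor_obj_of_isGE_of_isLE W 0
  refine ⟨N, Y, i, p ≫ e.hom, e.inv ≫ k, distTriang_of_iso₃ h e, ‹_›, ?_⟩
  have h₁ : Mono ((homologyFunctor A 0).map p) :=
    (HomologySequence.mono_homologyMap_mor₂_iff _ h 0).2
      ((isZero_of_isLE N (-1) 0 (by lia)).eq_of_src _ _)
  have h₂ : Epi ((homologyFunctor A 0).map p) :=
    (HomologySequence.epi_homologyMap_mor₂_iff _ h 0 1).2
      ((isZero_of_isLE N (-1) 1 (by lia)).eq_of_tgt _ _)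
  have := isIso_of_mono_of_epi ((homologyFunctor A 0).map p)
  exact torsionPart_of_iso h_H0 (asIso ((homologyFunctor A 0).map p) ≪≫
    (homologyFunctor A 0).mapIso e ≪≫ (singleFunctorCompHomologyFunctorIso A 0).app Y)

include hT in
-- `P` is an extension of the torsion object `H⁰(P)` by an object in degrees `≤ -1`, and `Hom(P,
-- -[1])` kills both.
lemma homVanish_self (h_H0 : torsionPart P ((homologyFunctor A 0).obj P)) : HomVanish P P 1 := by
  obtain ⟨N, Y, i, p, k, h, hN, hY⟩ := exists_truncation_twoTerm hT h_H0
  exact homVanish_mor₂ h 1 (homVanish_of_isLE hT (-1) 1 hN (by lia)) hY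

include hT in
lemma torsionPart_of_epi {X Y : A} (p : X ⟶ Y) [Epi p] (h : torsionPart P X) :
    torsionPart P Y := by
  rw [torsionPart_iff hT] at h ⊢
  intro g
  obtain ⟨l, hl⟩ := h (Projective.factorThru g p)
  exact ⟨l ≫ p, by rw [reassoc_of% hl, Projective.factorThru_comp]⟩

omit [Projective P₁] [Projective P₀] in
include hT in
lemma torsionFreePart_of_mono {X Y : A} (i : X ⟶ Y) [Mono i] (h : torsionFreePart P Y) :
    torsionFreePart P X := by
  rw [torsionFreePart_iff hT] at h ⊢
  intro u hu
  rw [← cancel_mono i, zero_comp]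
  exact h _ (by rw [reassoc_of% hu, zero_comp])

omit [Projective P₁] in
include hT in
lemma torsionPart_coproduct (hP₁ : IsSmallObject P₁) {J : Type v} (X : J → A) [HasCoproduct X]
    (h : ∀ j, torsionPart P (X j)) : torsionPart P (∐ X) := by
  rw [torsionPart_iff hT]
  intro g
  induction g using hP₁.hom_induction X with
  | hι j g =>
    obtain ⟨l, rfl⟩ := (torsionPart_iff hT _).1 (h j) g
    exact ⟨l ≫ Sigma.ι X j, by simp⟩
  | zero => exact ⟨0, comp_zero⟩
  | add f g hf hg =>
    obtain ⟨f', rfl⟩ := hf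
    obtain ⟨g', rfl⟩ := hg
    exact ⟨f' + g', Preadditive.comp_add _ _ _ _ _ _⟩

include hT in
lemma hom_eq_zero_of_torsion (h_inter : ∀ X : A, torsionPart P X → torsionFreePart P X → IsZero X)
    {X Y : A} (hX : torsionPart P X) (hY : torsionFreePart P Y) (f : X ⟶ Y) : f = 0 := by
  have hI := h_inter _ (torsionPart_of_epi hT (factorThruImage f) hX)
    (torsionFreePart_of_mono hT (image.ι f) hY)
  rw [← image.fac f, hI.eq_of_src (image.ι f) 0, comp_zero]

include hT in
/-- The torsion part of an object is the trace of `H⁰(P)`. -/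
lemma exists_torsion_shortExact [HasCoproducts.{v} A]
    (hP₁ : IsSmallObject P₁) (h_H0 : torsionPart P ((homologyFunctor A 0).obj P)) (X : A) :
    ∃ S : ShortComplex A, S.ShortExact ∧ torsionPart P S.X₁ ∧ torsionFreePart P S.X₃ ∧
      S.X₂ = X := by
  obtain ⟨N, Y, i, p, k, h, hN, hY⟩ := exists_truncation_twoTerm hT h_H0
  let φ : ∐ (fun _ : Y ⟶ X => Y) ⟶ X := Sigma.desc fun f => f
  have hI : torsionPart P (Limits.image φ) :=
    torsionPart_of_epi hT (factorThruImage φ) (torsionPart_coproduct hT hP₁ _ fun _ => hY)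
  refine ⟨ShortComplex.mk (image.ι φ) (cokernel.π (image.ι φ)) (cokernel.condition _), ?_, hI, ?_,
    rfl⟩
  · exact { exact := ShortComplex.exact_cokernel _ }
  · rw [torsionFreePart_iff hT]
    intro u hu
    dsimp at u hu
    obtain ⟨u', rfl⟩ : ∃ u', u' ≫ cokernel.π (image.ι φ) = u :=
      ⟨_, Projective.factorThru_comp u (cokernel.π (image.ι φ))⟩
    rw [← Category.assoc] at hu
    let hk := Abelian.monoIsKernelOfCokernel
      (CokernelCofork.ofπ (cokernel.π (image.ι φ)) (cokernel.condition _))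
      (cokernelIsCokernel (image.ι φ))
    -- The lift `u'` of `u` may be changed by a map into the image, which is torsion, so that it
    -- kills `d`. It then extends to `P ⟶ X`, which factors through `Y` and hence has the form `π ≫
    -- s`. As `s` is one of the components of `φ`, it dies in the cokernel.
    obtain ⟨g, hg⟩ : ∃ g, g ≫ image.ι φ = d ≫ u' := ⟨_, KernelFork.IsLimit.lift' hk _ hu |>.2⟩
    obtain ⟨l, rfl⟩ := (torsionPart_iff hT _).1 hI g
    have hd : d ≫ (u' - l ≫ image.ι φ) = 0 := by
      rw [Preadditive.comp_sub, ← hg, Category.assoc, sub_self]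
    obtain ⟨r, hr⟩ := exists_desc_mor₂ hT ((singleFunctor A 0).map (u' - l ≫ image.ι φ))
      (by rw [← Functor.map_comp, hd, Functor.map_zero])
    obtain ⟨s, hs⟩ := exists_desc_mor₂ h r (t.zero _ (-1) 0)
    obtain ⟨s, rfl⟩ := (singleFunctor A 0).map_surjective s
    obtain ⟨π, hπ⟩ := (singleFunctor A 0).map_surjective (a ≫ p)
    have hfac : u' - l ≫ image.ι φ = π ≫ s := (singleFunctor A 0).map_injective (by
      rw [hr, hs, Functor.map_comp, hπ, Category.assoc])
    have hs' : s = Sigma.ι (fun _ : Y ⟶ X => Y) s ≫ φ := by simp [φ]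
    rw [sub_eq_iff_eq_add, hs'] at hfac
    have hφ : φ ≫ cokernel.π (image.ι φ) = 0 := by
      have := factorThruImage φ ≫= cokernel.condition (image.ι φ)
      rwa [image.fac_assoc, comp_zero] at this
    simp [hfac, hφ]

end TwoTerm

/-! ### The tilted t-structure and its heart. -/

section Tilting

variable {A : Type u} [Category.{v} A] [Abelian A] [HasDerivedCategory.{w} A]

/-- Extensions of a torsion object in degree `0` by an object in degrees `≤ -1`. -/
def IsTiltedLE (P B : DerivedCategory A) : Prop :=
  ∃ (N : DerivedCategory A) (X : A) (n : N ⟶ B) (x : B ⟶ (singleFunctor A 0).obj X)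
    (k : (singleFunctor A 0).obj X ⟶ N⟦(1 : ℤ)⟧),
    Triangle.mk n x k ∈ distTriang (DerivedCategory A) ∧ N.IsLE (-1) ∧ torsionPart P X

/-- Extensions of an object in degrees `≥ 1` by a torsion-free object in degree `0`. -/
def IsTiltedGE (P B : DerivedCategory A) : Prop :=
  ∃ (Y : A) (E : DerivedCategory A) (y : (singleFunctor A 0).obj Y ⟶ B) (e : B ⟶ E)
    (k : E ⟶ ((singleFunctor A 0).obj Y)⟦(1 : ℤ)⟧),
    Triangle.mk y e k ∈ distTriang (DerivedCategory A) ∧ torsionFreePart P Y ∧ E.IsGE 1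

variable {P₁ P₀ : A} [Projective P₁] [Projective P₀] {d : P₁ ⟶ P₀} {P : DerivedCategory A}
  {a : (singleFunctor A 0).obj P₀ ⟶ P} {b : P ⟶ ((singleFunctor A 0).obj P₁)⟦(1 : ℤ)⟧}
  (hT : Triangle.mk ((singleFunctor A 0).map d) a b ∈ distTriang (DerivedCategory A))

include hT in
lemma IsTiltedLE.homLE {B : DerivedCategory A} (h : IsTiltedLE P B) : homLE P 0 B := by
  obtain ⟨N, X, n, x, k, h, hN, hX⟩ := h
  exact homLE_mor₂ h (homLE_of_isLE hT 0 hN) (homLE_of_torsionPart hT hX)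

omit [Projective P₁] [Projective P₀] in
include hT in
lemma IsTiltedGE.homGE {B : DerivedCategory A} (h : IsTiltedGE P B) : homGE P 1 B := by
  obtain ⟨Y, E, y, e, k, h, hY, hE⟩ := h
  exact homGE_mor₂ h (homGE_of_torsionFreePart hT hY) (homGE_of_isGE hT 1 hE)

include hT in
lemma IsTiltedLE.hom_eq_zero
    (h_inter : ∀ X : A, torsionPart P X → torsionFreePart P X → IsZero X)
    {B B' : DerivedCategory A} (h : IsTiltedLE P B) (h' : IsTiltedGE P B') (f : B ⟶ B') :
    f = 0 := by
  obtain ⟨N, X, n, x, k, h, hN, hX⟩ := h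
  obtain ⟨Y, E, y, e, k', h', hY, hE⟩ := h'
  refine eq_zero_from_mor₂ h (eq_zero_to_mor₂ h' ?_ ?_) (eq_zero_to_mor₂ h' ?_ ?_) f
  · exact fun u => t.zero u (-1) 0
  · exact fun u => t.zero u (-1) 1
  · intro u
    obtain ⟨u, rfl⟩ := (singleFunctor A 0).map_surjective u
    rw [hom_eq_zero_of_torsion hT h_inter hX hY u, Functor.map_zero]
  · exact fun u => t.zero u 0 1

include hT in
lemma exists_tilted_triangle [HasCoproducts.{v} A] (hP₁ : IsSmallObject P₁)
    (h_H0 : torsionPart P ((homologyFunctor A 0).obj P)) (Z : DerivedCategory A) :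
    ∃ (U V : DerivedCategory A) (i : U ⟶ Z) (p : Z ⟶ V) (k : V ⟶ U⟦(1 : ℤ)⟧),
      Triangle.mk i p k ∈ distTriang (DerivedCategory A) ∧ IsTiltedLE P U ∧ IsTiltedGE P V := by
  obtain ⟨Z', E, hZ', hE, z, e, l, hZ⟩ := t.exists_triangle Z 0 1 (by lia)
  obtain ⟨N, W, hN, hW, n, x, m, h⟩ := t.exists_triangle Z' (-1) 0 (by lia)
  have : Z'.IsLE 0 := ⟨hZ'⟩
  have : E.IsGE 1 := ⟨hE⟩
  have : N.IsLE (-1) := ⟨hN⟩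
  have : W.IsGE 0 := ⟨hW⟩
  have : W.IsLE 0 := by
    have := t.isLE_shift N (-1) 1 (-2)
    exact t.isLE₂ _ (rot_of_distTriang _ h) 0 ‹_› (t.isLE_of_le (N⟦(1 : ℤ)⟧) (-2) 0)
  obtain ⟨X, ⟨ε⟩⟩ := exists_iso_singleFunctor_obj_of_isGE_of_isLE W 0
  obtain ⟨S, hS, h₁, h₃, rfl⟩ := exists_torsion_shortExact hT hP₁ h_H0 X
  -- `U'[-1]` is the fibre of `Z' ⟶ H⁰(Z') ⟶ S.X₃`, so it keeps the negative part and the torsion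
  -- part `S.X₁`. The octahedron axiom gives its extension structure, and a second octahedron gives
  -- that of `V`.
  obtain ⟨U', v, w, hU⟩ := distinguished_cocone_triangle
    ((x ≫ ε.hom) ≫ (singleFunctor A 0).map S.g)
  obtain ⟨f, g, k, hU'⟩ := exists_distTriang_of_shift (Triangulated.someOctahedron rfl
    (rot_of_distTriang _ (distTriang_of_iso₃ h ε))
    (rot_of_distTriang _ hS.singleTriangle_distinguished) hU).mem
  have hU₂ := inv_rot_of_distTriang _ hU
  obtain ⟨V, p, q, hV⟩ := distinguished_cocone_triangle
    ((Triangle.mk ((x ≫ ε.hom) ≫ (singleFunctor A 0).map S.g) v w).invRotate.mor₁ ≫ z)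
  exact ⟨_, V, _, p, q, hV, ⟨N, S.X₁, f, g, k, hU', ‹_›, h₁⟩,
    ⟨S.X₃, E, _, _, _, (Triangulated.someOctahedron rfl hU₂ hZ hV).mem, h₃, ‹_›⟩⟩

include hT in
-- Composition with `d` is bijective from `Hom(P₀, V[i])` to `Hom(P₁, V[i])`. The object `Y`
-- representing these groups is therefore both torsion and torsion-free, hence zero, and `Hⁱ(V)`
-- vanishes with it.
lemma isZero_of_homVanish (h_inter : ∀ X : A, torsionPart P X → torsionFreePart P X → IsZero X)
    {V : DerivedCategory A} (hV : ∀ i, HomVanish P V i) : IsZero V := by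
  have hH (i : ℤ) : IsZero ((homologyFunctor A i).obj V) := by
    obtain ⟨Y, e, he, hY⟩ := exists_equiv_of_projective (V⟦i⟧)
    have inj (u v : (singleFunctor A 0).obj P₀ ⟶ V⟦i⟧)
        (h : (singleFunctor A 0).map d ≫ u = (singleFunctor A 0).map d ≫ v) : u = v := by
      obtain ⟨l, hl⟩ := exists_desc_mor₂ hT (u - v) (by rw [Preadditive.comp_sub, h, sub_self])
      rw [hV i l, comp_zero] at hl
      exact sub_eq_zero.1 hl
    have surj (v : (singleFunctor A 0).obj P₁ ⟶ V⟦i⟧) :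
        ∃ u, v = (singleFunctor A 0).map d ≫ u := by
      obtain ⟨l, hl⟩ := exists_desc_shift_mor₁ hT (v⟦(1 : ℤ)⟧')
        ((homVanish_shift_iff i 1 (i + 1) rfl).2 (hV _) _)
      obtain ⟨l, rfl⟩ := (shiftFunctor (DerivedCategory A) (1 : ℤ)).map_surjective l
      rw [← Functor.map_comp] at hl
      exact ⟨l, (shiftFunctor (DerivedCategory A) (1 : ℤ)).map_injective hl⟩
    have hY' : IsZero ((homologyFunctor A 0).obj (V⟦i⟧)) := by
      refine hY (h_inter Y ((torsionPart_iff hT Y).2 fun g => ?_)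
        ((torsionFreePart_iff hT Y).2 fun u hu => ?_))
      · obtain ⟨g, rfl⟩ := (e P₁).surjective g
        obtain ⟨h, rfl⟩ := surj g
        exact ⟨e P₀ h, (he _ _ d h).symm⟩
      · obtain ⟨u, rfl⟩ := (e P₀).surjective u
        -- Additivity of `e` is not part of its description; naturality along the zero map suffices.
        have h₀ : e P₀ 0 = 0 := by
          have := he P₀ P₀ 0 0
          rwa [comp_zero, zero_comp] at this
        rw [← h₀]
        refine congrArg _ (inj _ _ ((e P₁).injective ?_))
        rw [he, hu, he, h₀, comp_zero]
    exact hY'.of_iso (((homologyFunctor A 0).shiftIso i 0 i (by simp)).symm.app V)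
  have : V.IsLE 0 := (isLE_iff _ _).2 fun i _ => hH i
  have : V.IsGE 1 := (isGE_iff _ _).2 fun i _ => hH i
  exact (IsZero.iff_id_eq_zero _).2 (t.zero _ 0 1)

variable [HasCoproducts.{v} A] (hP₁ : IsSmallObject P₁)
  (h_H0 : torsionPart P ((homologyFunctor A 0).obj P))
  (h_inter : ∀ X : A, torsionPart P X → torsionFreePart P X → IsZero X)
include hT hP₁ h_H0 h_inter

/-- In the tilted triangle, `V` receives no map from `P` in positive degrees because of `Z` and `U`,
and none in the other degrees because it is tilted. Hence `V = 0` and `U ≅ Z`. -/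
lemma isTiltedLE_of_homLE {Z : DerivedCategory A} (hZ : homLE P 0 Z) : IsTiltedLE P Z := by
  obtain ⟨U, V, i, p, k, h, hU, hV⟩ := exists_tilted_triangle hT hP₁ h_H0 Z
  have hV₀ : IsZero V := isZero_of_homVanish hT h_inter fun n => by
    by_cases hn : 0 < n
    · exact homVanish_mor₃ h n _ rfl (hZ n hn) (hU.homLE hT _ (by lia))
    · exact hV.homGE hT n (by lia)
  have : IsIso i := (Triangle.isZero₃_iff_isIso₁ _ h).1 hV₀
  obtain ⟨N, X, n, x, k, h', hN, hX⟩ := hU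
  exact ⟨N, X, _, _, _, distTriang_of_iso₂ h' (asIso i), hN, hX⟩

lemma isTiltedGE_of_homGE {Z : DerivedCategory A} (hZ : homGE P 1 Z) : IsTiltedGE P Z := by
  obtain ⟨U, V, i, p, k, h, hU, hV⟩ := exists_tilted_triangle hT hP₁ h_H0 Z
  have hU₀ : IsZero U := isZero_of_homVanish hT h_inter fun n => by
    by_cases hn : 0 < n
    · exact hU.homLE hT n hn
    · exact homVanish_mor₁ h (n - 1) n (by lia) (hV.homGE hT _ (by lia)) (hZ n (by lia))
  have : IsIso p := (Triangle.isZero₁_iff_isIso₂ _ h).1 hU₀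
  obtain ⟨Y, E, y, e, k, h', hY, hE⟩ := hV
  exact ⟨Y, E, _, _, _, distTriang_of_iso₂ h' (asIso p).symm, hY, hE⟩

lemma hom_eq_zero_of_homLE_of_homGE {X Y : DerivedCategory A} (hX : homLE P 0 X)
    (hY : homGE P 1 Y) (f : X ⟶ Y) : f = 0 :=
  (isTiltedLE_of_homLE hT hP₁ h_H0 h_inter hX).hom_eq_zero hT h_inter
    (isTiltedGE_of_homGE hT hP₁ h_H0 h_inter hY) f

lemma exists_triangle_of_heart {Z : DerivedCategory A} (hZ : heart P Z) :
    ∃ (Y X : A) (y : ((singleFunctor A 0).obj Y)⟦(1 : ℤ)⟧ ⟶ Z)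
      (x : Z ⟶ (singleFunctor A 0).obj X)
      (k : (singleFunctor A 0).obj X ⟶ ((singleFunctor A 0).obj Y)⟦(1 : ℤ)⟧⟦(1 : ℤ)⟧),
      Triangle.mk y x k ∈ distTriang (DerivedCategory A) ∧
        torsionFreePart P Y ∧ torsionPart P X := by
  obtain ⟨N, X, n, x, k, h, hN, hX⟩ := isTiltedLE_of_homLE hT hP₁ h_H0 h_inter hZ.1
  obtain ⟨Y, E, y, e, l, h', hY, hE⟩ := isTiltedGE_of_homGE hT hP₁ h_H0 h_inter
    (homGE_shift hZ.2 (-1) 1 (by lia))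
  -- `Z` lies in degrees `≥ -1`, hence so does the fibre `N` of `Z ⟶ X`. As `N` also lies in degrees
  -- `≤ -1`, it is `Y'[1]` for an object `Y'` of `A`.
  have : t.IsGE (Z⟦(-1 : ℤ)⟧) 0 :=
    t.isGE₂ _ h' 0 (inferInstanceAs (((singleFunctor A 0).obj Y).IsGE 0)) (t.isGE_of_ge E 0 1)
  have : t.IsGE Z (-1) := t.isGE_of_shift Z (-1) (-1) 0
  have : t.IsGE N (-1) := by
    have := t.isGE_shift ((singleFunctor A 0).obj X) 0 (-1) 1
    exact t.isGE₂ _ (inv_rot_of_distTriang _ h) (-1)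
      (t.isGE_of_ge (((singleFunctor A 0).obj X)⟦(-1 : ℤ)⟧) (-1) 1) ‹_›
  have : IsGE (N⟦(-1 : ℤ)⟧) 0 := t.isGE_shift N (-1) (-1) 0
  have : IsLE (N⟦(-1 : ℤ)⟧) 0 := t.isLE_shift N (-1) (-1) 0
  obtain ⟨Y', ⟨ε⟩⟩ := exists_iso_singleFunctor_obj_of_isGE_of_isLE (N⟦(-1 : ℤ)⟧) 0
  let ε' : N ≅ ((singleFunctor A 0).obj Y')⟦(1 : ℤ)⟧ :=
    (shiftEquiv (DerivedCategory A) (1 : ℤ)).counitIso.symm.app N ≪≫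
      (shiftFunctor (DerivedCategory A) (1 : ℤ)).mapIso ε
  have h₁ := distTriang_of_iso₁ h ε'
  refine ⟨Y', X, _, _, _, h₁, ?_, hX⟩
  refine homVanish_zero_iff.1 ((homVanish_shift_iff 1 (-1) 0 (by lia)).1 ?_)
  exact homVanish_mor₁ h₁ (-2) (-1) (by lia)
    (homVanish_of_isGE hT 0 (-2) inferInstance (by lia)) (hZ.2 (-1) (by lia))

omit h_inter in
/-- The truncation of `Z`, with respect to `P`, at `≤ -1` and `≥ 0`. -/
lemma exists_triangle_homLE_homGE (Z : DerivedCategory A) :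
    ∃ (U V : DerivedCategory A) (i : U⟦(1 : ℤ)⟧ ⟶ Z) (p : Z ⟶ V)
      (k : V ⟶ U⟦(1 : ℤ)⟧⟦(1 : ℤ)⟧),
      Triangle.mk i p k ∈ distTriang (DerivedCategory A) ∧ homLE P 0 U ∧ homGE P 0 V := by
  obtain ⟨U, V, i, p, k, h, hU, hV⟩ := exists_tilted_triangle hT hP₁ h_H0 (Z⟦(-1 : ℤ)⟧)
  exact ⟨U, V⟦(1 : ℤ)⟧, _, _, _, distTriang_of_iso₂ (Triangle.shift_distinguished _ h 1)
    ((shiftEquiv (DerivedCategory A) (1 : ℤ)).counitIso.app Z), hU.homLE hT,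
    homGE_shift (hV.homGE hT) 1 0 (by lia)⟩

theorem isAdmissibleAbelian_heart : IsAdmissibleAbelian (heart P) where
  isClosedUnderFiniteProducts := by
    refine ⟨fun J _ => ⟨?_⟩⟩
    rintro X ⟨p⟩
    have (i : ℤ) (h : ∀ j, HomVanish P (p.diag.obj j) i) : HomVanish P X i := fun f =>
      (isLimitOfPreserves (shiftFunctor (DerivedCategory A) i) p.isLimit).hom_ext fun j =>
        (h j _).trans zero_comp.symm
    exact ⟨fun i hi => this i fun j => (p.prop_diag_obj j).1 i hi,
      fun i hi => this i fun j => (p.prop_diag_obj j).2 i hi⟩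
  hom_shift_eq_zero X Y hX hY n hn :=
    hom_eq_zero_of_homLE_of_homGE hT hP₁ h_H0 h_inter hX.1 (homGE_shift hY.2 n 1 (by lia))
  admissible X Y f Z g k h := by
    -- The cone of `f` has Hom from `P` only in degrees `-1` and `0`. Truncating it between these
    -- degrees leaves the kernel `U` and the cokernel `V`.
    obtain ⟨U, V, i, p, l, h', hU, hV⟩ :=
      exists_triangle_homLE_homGE hT hP₁ h_H0 Z
    have hZ₁ : homLE P 0 Z := homLE_mor₃ h Y.2.1 fun i hi => X.2.1 i (by lia)
    have hZ₂ : homGE P (-1) Z := homGE_mor₃ h (fun i hi => Y.2.2 i (by lia)) X.2.2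
    refine ⟨⟨U, hU, fun j hj => ?_⟩, ⟨V, homLE_mor₃ h' hZ₁ (homLE_shift hU 1 1 (by lia)), hV⟩,
      i, p, l, h'⟩
    exact (homVanish_shift_iff 1 (j - 1) j (by lia)).1
      (homVanish_mor₁ h' (j - 1 - 1) _ (by lia) (hV _ (by lia)) (hZ₂ _ (by lia)))

end Tilting

/-! ### Torsion theories from orthogonality, and short exact sequences from triangles. -/

section TorsionTheory

/-- Closure under quotients and subobjects is automatic: orthogonality kills one map of the
decomposition of the quotient or subobject, so the other is an isomorphism. -/
lemma IsTorsionTheory.of_hom_eq_zero {𝒞 : Type u} [Category.{v} 𝒞] [Abelian 𝒞]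
    {𝒳 𝒴 : ObjectProperty 𝒞} [𝒳.IsClosedUnderIsomorphisms] [𝒴.IsClosedUnderIsomorphisms]
    (h𝒳 : ∀ Z, IsZero Z → 𝒳 Z) (h𝒴 : ∀ Z, IsZero Z → 𝒴 Z)
    (hom_eq_zero : ∀ ⦃X Y : 𝒞⦄, 𝒳 X → 𝒴 Y → ∀ f : X ⟶ Y, f = 0)
    (exists_shortExact : ∀ Z : 𝒞, ∃ (X' X'' : 𝒞) (f : X' ⟶ Z) (g : Z ⟶ X'') (hfg : f ≫ g = 0),
      (ShortComplex.mk f g hfg).ShortExact ∧ 𝒳 X' ∧ 𝒴 X'') :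
    IsTorsionTheory 𝒳 𝒴 where
  inter_iff Z := ⟨fun h => (IsZero.iff_id_eq_zero _).2 (hom_eq_zero h.1 h.2 _),
    fun h => ⟨h𝒳 Z h, h𝒴 Z h⟩⟩
  isClosedUnderQuotients := ⟨fun {W Z} p _ hW => by
    obtain ⟨X', X'', f, g, hfg, h, hX', hX''⟩ := exists_shortExact Z
    have hg : g = 0 := by
      rw [← cancel_epi p, comp_zero]
      exact hom_eq_zero hW hX'' _
    have := h.mono_f
    have : Epi f := h.exact.epi_f hg
    have := isIso_of_mono_of_epi f
    exact 𝒳.prop_of_iso (asIso f) hX'⟩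
  isClosedUnderSubobjects := ⟨fun {W Z} i _ hZ => by
    obtain ⟨X', X'', f, g, hfg, h, hX', hX''⟩ := exists_shortExact W
    have hf : f = 0 := by
      rw [← cancel_mono i, zero_comp]
      exact hom_eq_zero hX' hZ _
    have := h.epi_g
    have : Mono g := h.exact.mono_g hf
    have := isIso_of_mono_of_epi g
    exact 𝒴.prop_of_iso (asIso g).symm hX''⟩
  exists_shortExact := exists_shortExact

variable {T : Type u} [Category.{v} T] [HasZeroObject T] [Preadditive T] [HasShift T ℤ]
  [∀ n : ℤ, (shiftFunctor T n).Additive] [Pretriangulated T] [IsTriangulated T]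

lemma IsAdmissibleAbelian.shortExact {S : ObjectProperty T} (h : IsAdmissibleAbelian S)
    {X Y Z : S.FullSubcategory} (f : X ⟶ Y) (g : Y ⟶ Z) (k : Z.obj ⟶ X.obj⟦(1 : ℤ)⟧)
    (hT : Triangle.mk f.hom g.hom k ∈ distTriang T) :
    letI := h.abelian
    ∃ hfg : f ≫ g = 0, (ShortComplex.mk f g hfg).ShortExact := by
  let := h.abelian
  have := h.isClosedUnderFiniteProducts
  have hι ⦃X Y : S.FullSubcategory⦄ ⦃n : ℤ⦄ (f : S.ι.obj X ⟶ (S.ι.obj Y)⟦n⟧) (hn : n < 0) :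
      f = 0 := h.hom_shift_eq_zero X.property Y.property hn f
  have hk := Triangulated.AbelianSubcategory.isLimitKernelForkOfDistTriang (ι := S.ι)
    hι f g k hT
  have hc := Triangulated.AbelianSubcategory.isColimitCokernelCoforkOfDistTriang (ι := S.ι)
    hι f g k hT
  refine ⟨S.ι.map_injective (mor₁_comp_mor₂ hT), ?_⟩
  exact { exact := ShortComplex.exact_of_f_is_kernel _ hk
          mono_f := Fork.IsLimit.mono hk
          epi_g := Cofork.IsColimit.epi hc }

end TorsionTheory

/-! ### The torsion theory in the heart. -/

section Heart

variable {A : Type u} [Category.{v} A] [Abelian A] [HasDerivedCategory.{w} A]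
  {P₁ P₀ : A} [Projective P₁] [Projective P₀] {d : P₁ ⟶ P₀} {P : DerivedCategory A}
  {a : (singleFunctor A 0).obj P₀ ⟶ P} {b : P ⟶ ((singleFunctor A 0).obj P₁)⟦(1 : ℤ)⟧}
  (hT : Triangle.mk ((singleFunctor A 0).map d) a b ∈ distTriang (DerivedCategory A))

include hT in
lemma inDegreeZeroShift_le_heart :
    inDegreeZeroShift (torsionFreePart P) ≤ heart P := by
  rintro Z ⟨Y, hY, ⟨e⟩⟩
  refine heart_of_iso ⟨homLE_of_isLE hT 0 (isLE_single_shift Y), ?_⟩ e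
  exact homGE_shift (homGE_of_torsionFreePart hT hY) 1 0 (by lia)

include hT in
lemma inDegreeZero_le_heart : inDegreeZero (torsionPart P) ≤ heart P := by
  rintro Z ⟨X, hX, ⟨e⟩⟩
  exact heart_of_iso ⟨homLE_of_torsionPart hT hX, homGE_of_isGE hT 0 inferInstance⟩ e

include hT in
lemma isTorsionTheory_heart [HasCoproducts.{v} A] (hP₁ : IsSmallObject P₁)
    (h_H0 : torsionPart P ((homologyFunctor A 0).obj P))
    (h_inter : ∀ X : A, torsionPart P X → torsionFreePart P X → IsZero X)
    (h : IsAdmissibleAbelian (heart P)) :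
    letI := h.abelian
    IsTorsionTheory ((inDegreeZeroShift (torsionFreePart P)).inverseImage (heart P).ι)
      ((inDegreeZero (torsionPart P)).inverseImage (heart P).ι) := by
  let := h.abelian
  have : (inDegreeZeroShift (torsionFreePart P)).IsClosedUnderIsomorphisms := by
    unfold inDegreeZeroShift; infer_instance
  have : (inDegreeZero (torsionPart P)).IsClosedUnderIsomorphisms := by
    unfold inDegreeZero; infer_instance
  have hz (Z : (heart P).FullSubcategory) (hZ : IsZero Z) : IsZero Z.obj :=
    (IsZero.iff_id_eq_zero _).2 (congrArg (fun f => f.hom) (hZ.eq_of_src (𝟙 Z) 0))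
  have h0 : IsZero ((singleFunctor A 0).obj 0) := (singleFunctor A 0).map_isZero (isZero_zero A)
  refine IsTorsionTheory.of_hom_eq_zero (fun Z hZ => ?_) (fun Z hZ => ?_) ?_ ?_
  · exact ⟨0, fun f => h0.eq_of_tgt _ _,
      ⟨((shiftFunctor (DerivedCategory A) (1 : ℤ)).map_isZero h0).iso (hz Z hZ)⟩⟩
  · exact ⟨0, fun f => ((shiftFunctor (DerivedCategory A) (1 : ℤ)).map_isZero h0).eq_of_tgt _ _,
      ⟨h0.iso (hz Z hZ)⟩⟩
  · rintro X Y ⟨X₀, hX, ⟨e⟩⟩ ⟨Y₀, hY, ⟨e'⟩⟩ f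
    have : t.IsLE ((singleFunctor A 0 ⋙ shiftFunctor (DerivedCategory A) (1 : ℤ)).obj X₀) (-1) :=
      isLE_single_shift.{w} X₀
    exact (heart P).ι.map_injective (eq_zero_of_iso e e' (fun f => t.zero f (-1) 0) _)
  · intro Z
    obtain ⟨Y, X, y, x, k, hZ, hY, hX⟩ := exists_triangle_of_heart hT hP₁ h_H0 h_inter Z.2
    have hY' : inDegreeZeroShift (torsionFreePart P) (((singleFunctor A 0).obj Y)⟦(1 : ℤ)⟧) :=
      ⟨Y, hY, ⟨Iso.refl _⟩⟩
    have hX' : inDegreeZero (torsionPart P) ((singleFunctor A 0).obj X) :=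
      ⟨X, hX, ⟨Iso.refl _⟩⟩
    let Y' : (heart P).FullSubcategory := ⟨_, inDegreeZeroShift_le_heart hT _ hY'⟩
    let X' : (heart P).FullSubcategory := ⟨_, inDegreeZero_le_heart hT _ hX'⟩
    obtain ⟨h₀, hS⟩ := h.shortExact (X := Y') (Y := Z) (Z := X')
      (ObjectProperty.homMk y) (ObjectProperty.homMk x) k hZ
    exact ⟨Y', X', _, _, h₀, hS, hY', hX'⟩

end Heart

/-! ### Coproducts in a triangulated category and finitely supported maps. -/

section CoproductFamily

/-- The morphisms `ι j : X j ⟶ Y` exhibit `Y` as a coproduct of the objects `X j`. -/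
def IsCoproductFamily {T : Type u} [Category.{w} T] [HasZeroMorphisms T] {J : Type v}
    {X : J → T} {Y : T} (ι : ∀ j, X j ⟶ Y) : Prop :=
  ∀ V : T, (∀ g : ∀ j, X j ⟶ V, ∃ f : Y ⟶ V, ∀ j, ι j ≫ f = g j) ∧
    ∀ f : Y ⟶ V, (∀ j, ι j ≫ f = 0) → f = 0

variable {T : Type u} [Category.{w} T] [Preadditive T] {J : Type v}

lemma IsCoproductFamily.hom_ext {X : J → T} {Y : T} {ι : ∀ j, X j ⟶ Y}
    (h : IsCoproductFamily ι) {V : T} {f g : Y ⟶ V} (hfg : ∀ j, ι j ≫ f = ι j ≫ g) : f = g :=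
  sub_eq_zero.1 ((h V).2 _ fun j => by rw [Preadditive.comp_sub, hfg, sub_self])

lemma IsCoproductFamily.exists_projections [DecidableEq J] {X Y : T} {ι : J → (X ⟶ Y)}
    (h : IsCoproductFamily ι) :
    ∃ π : J → (Y ⟶ X), ∀ i j, ι i ≫ π j = if i = j then 𝟙 X else 0 := by
  choose π hπ using fun j => (h X).1 fun i => if i = j then 𝟙 X else 0
  exact ⟨π, fun i j => hπ j i⟩

/-- A morphism `ψ` to a coproduct which is supported on a finite subset of the index set. -/
def IsFinitelySupported {X Y W : T} (ι : J → (X ⟶ Y)) (π : J → (Y ⟶ X)) (ψ : W ⟶ Y) : Prop :=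
  ∃ S : Finset J, ∀ S', S ⊆ S' → ψ = ∑ j ∈ S', ψ ≫ π j ≫ ι j

section

variable {X Y W : T} {ι : J → (X ⟶ Y)} {π : J → (Y ⟶ X)}

lemma IsFinitelySupported.zero : IsFinitelySupported ι π (0 : W ⟶ Y) := ⟨∅, by simp⟩

lemma IsFinitelySupported.add [DecidableEq J] {ψ φ : W ⟶ Y} (hψ : IsFinitelySupported ι π ψ)
    (hφ : IsFinitelySupported ι π φ) : IsFinitelySupported ι π (ψ + φ) := by
  obtain ⟨S, hS⟩ := hψ
  obtain ⟨S', hS'⟩ := hφ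
  refine ⟨S ∪ S', fun S'' h => ?_⟩
  simp only [Preadditive.add_comp, Finset.sum_add_distrib]
  rw [← hS _ (Finset.subset_union_left.trans h), ← hS' _ (Finset.subset_union_right.trans h)]

lemma IsFinitelySupported.comp_left {W' : T} {ψ : W ⟶ Y} (hψ : IsFinitelySupported ι π ψ)
    (u : W' ⟶ W) : IsFinitelySupported ι π (u ≫ ψ) := by
  obtain ⟨S, hS⟩ := hψ
  refine ⟨S, fun S' h => ?_⟩
  simp only [Category.assoc]
  rw [← Preadditive.comp_sum, ← hS _ h]

lemma IsFinitelySupported.comp_ι [DecidableEq J]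
    (hπ : ∀ i j, ι i ≫ π j = if i = j then 𝟙 X else 0) (j : J) (u : W ⟶ X) :
    IsFinitelySupported ι π (u ≫ ι j) := by
  refine ⟨{j}, fun S' h => ?_⟩
  rw [Finset.sum_eq_single_of_mem j (h (by simp))]
  · rw [Category.assoc, reassoc_of% (hπ j j), if_pos True.intro, Category.id_comp]
  · intro i _ hi
    rw [Category.assoc, reassoc_of% (hπ j i), if_neg (Ne.symm hi), zero_comp, comp_zero]

lemma IsFinitelySupported.sum [DecidableEq J]
    (hπ : ∀ i j, ι i ≫ π j = if i = j then 𝟙 X else 0) (S : Finset J) (u : J → (W ⟶ X)) :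
    IsFinitelySupported ι π (∑ j ∈ S, u j ≫ ι j) := by
  induction S using Finset.induction_on with
  | empty => simpa using IsFinitelySupported.zero
  | insert j S hj ih =>
    rw [Finset.sum_insert hj]
    exact (IsFinitelySupported.comp_ι hπ j _).add ih

end

variable [HasShift T ℤ] [∀ n : ℤ, (shiftFunctor T n).Additive]

lemma IsCoproductFamily.shift {X : J → T} {Y : T} {ι : ∀ j, X j ⟶ Y}
    (h : IsCoproductFamily ι) : IsCoproductFamily fun j => (ι j)⟦(1 : ℤ)⟧' := by
  intro V
  let e : V⟦(-1 : ℤ)⟧⟦(1 : ℤ)⟧ ≅ V := (shiftEquiv T (1 : ℤ)).counitIso.app V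
  constructor
  · intro g
    choose g' hg' using fun j => (shiftFunctor T (1 : ℤ)).map_surjective (g j ≫ e.inv)
    obtain ⟨f, hf⟩ := (h _).1 g'
    refine ⟨f⟦(1 : ℤ)⟧' ≫ e.hom, fun j => ?_⟩
    rw [← Functor.map_comp_assoc, hf, hg', Category.assoc, e.inv_hom_id, Category.comp_id]
  · intro f hf
    obtain ⟨f', hf'⟩ := (shiftFunctor T (1 : ℤ)).map_surjective (f ≫ e.inv)
    have : f' = 0 := (h _).2 _ fun j => (shiftFunctor T (1 : ℤ)).map_injective (by
      rw [Functor.map_comp, hf', reassoc_of% (hf j), zero_comp, Functor.map_zero])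
    rw [this, Functor.map_zero] at hf'
    rw [← cancel_mono e.inv, ← hf', zero_comp]

variable [HasZeroObject T] [Pretriangulated T]

/-- This is a five lemma argument done by hand: it works for any choice of the noncanonical fillers
`γ j`. -/
lemma IsCoproductFamily.of_distTriang {A B C A' B' C' : T}
    {f : A ⟶ B} {g : B ⟶ C} {k : C ⟶ A⟦(1 : ℤ)⟧} {f' : A' ⟶ B'} {g' : B' ⟶ C'}
    {k' : C' ⟶ A'⟦(1 : ℤ)⟧} (h : Triangle.mk f g k ∈ distTriang T)
    (h' : Triangle.mk f' g' k' ∈ distTriang T)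
    {α : J → (A ⟶ A')} {β : J → (B ⟶ B')} {γ : J → (C ⟶ C')}
    (comm₁ : ∀ j, f ≫ β j = α j ≫ f') (comm₂ : ∀ j, g ≫ γ j = β j ≫ g')
    (comm₃ : ∀ j, k ≫ (α j)⟦(1 : ℤ)⟧' = γ j ≫ k')
    (hα : IsCoproductFamily α) (hβ : IsCoproductFamily β) : IsCoproductFamily γ := by
  intro V
  constructor
  · intro u
    obtain ⟨v, hv⟩ := (hβ V).1 fun j => g ≫ u j
    obtain ⟨y, rfl⟩ := exists_desc_mor₂ h' v ((hα V).2 _ fun j => by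
      rw [← reassoc_of% comm₁, hv, reassoc_of% (mor₁_comp_mor₂ h), zero_comp])
    have hy (j : J) : ∃ l : A⟦(1 : ℤ)⟧ ⟶ V, u j - γ j ≫ y = k ≫ l :=
      exists_desc_mor₃ h _ (by
        rw [Preadditive.comp_sub, reassoc_of% comm₂, hv, sub_self])
    choose l hl using hy
    obtain ⟨m, hm⟩ := (hα.shift V).1 l
    refine ⟨y + k' ≫ m, fun j => ?_⟩
    rw [Preadditive.comp_add, ← reassoc_of% comm₃, hm, ← hl, add_sub_cancel]
  · intro u hu
    obtain ⟨l, rfl⟩ := exists_desc_mor₃ h' u ((hβ V).2 _ fun j => by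
      rw [← reassoc_of% comm₂, hu, comp_zero])
    have hl (j : J) : ∃ m : B⟦(1 : ℤ)⟧ ⟶ V, (α j)⟦(1 : ℤ)⟧' ≫ l = f⟦(1 : ℤ)⟧' ≫ m :=
      exists_desc_shift_mor₁ h _ (by rw [reassoc_of% comm₃, hu])
    choose m hm using hl
    obtain ⟨n, hn⟩ := (hβ.shift V).1 m
    have : l = f'⟦(1 : ℤ)⟧' ≫ n := hα.shift.hom_ext fun j => by
      rw [hm, ← hn, ← Functor.map_comp_assoc, comm₁, Functor.map_comp_assoc]
    rw [this, reassoc_of% (mor₃_comp_mor₁ h'), zero_comp]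

end CoproductFamily

/-! ### Coproducts of copies of `P` and free objects of the heart. -/

section FreeObjects

variable {A : Type u} [Category.{v} A] [Abelian A] [HasDerivedCategory.{w} A]

/-- The coproduct is again projective, so maps from it and from its summands to `V` are all
represented by the same object of `A`. -/
lemma isCoproductFamily_single {J : Type v} (X : J → A) [HasCoproduct X] [∀ j, Projective (X j)] :
    IsCoproductFamily fun j => (singleFunctor A 0).map (Sigma.ι X j) := by
  intro V
  obtain ⟨Y, e, he, -⟩ := exists_equiv_of_projective V
  have he₀ (Q : A) [Projective Q] : e Q 0 = 0 := by
    have := he Q Q 0 0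
    rwa [comp_zero, zero_comp] at this
  constructor
  · intro g
    refine ⟨(e _).symm (Sigma.desc fun j => e _ (g j)), fun j => (e _).injective ?_⟩
    rw [he, Equiv.apply_symm_apply, Sigma.ι_desc]
  · intro f hf
    apply (e _).injective
    rw [he₀]
    ext j
    rw [← he, hf, he₀, comp_zero]

variable {P₁ P₀ : A} [Projective P₁] [Projective P₀] {d : P₁ ⟶ P₀} {P : DerivedCategory A}
  {a : (singleFunctor A 0).obj P₀ ⟶ P} {b : P ⟶ ((singleFunctor A 0).obj P₁)⟦(1 : ℤ)⟧}
  (hT : Triangle.mk ((singleFunctor A 0).map d) a b ∈ distTriang (DerivedCategory A))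

include hT in
lemma exists_coproduct_twoTerm [HasCoproducts.{v} A] (hP₁ : IsSmallObject P₁)
    (hP₀ : IsSmallObject P₀) (h_H0 : torsionPart P ((homologyFunctor A 0).obj P))
    (J : Type v) [DecidableEq J] :
    ∃ (Q : DerivedCategory A) (ι : J → (P ⟶ Q)) (π : J → (Q ⟶ P)),
      IsCoproductFamily ι ∧ (∀ i j, ι i ≫ π j = if i = j then 𝟙 P else 0) ∧
      (∀ φ : P ⟶ Q, IsFinitelySupported ι π φ) ∧ homLE P 0 Q := by
  let ι₁ := Sigma.ι fun _ : J => P₁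
  let ι₀ := Sigma.ι fun _ : J => P₀
  let D : ∐ (fun _ : J => P₁) ⟶ ∐ (fun _ : J => P₀) := Limits.Sigma.map fun _ => d
  have hD (j : J) : d ≫ ι₀ j = ι₁ j ≫ D := by simp [ι₀, ι₁, D]
  obtain ⟨Q, α, β, hQ⟩ := distinguished_cocone_triangle ((singleFunctor A 0).map D)
  have comm₁ (j : J) : (singleFunctor A 0).map d ≫ (singleFunctor A 0).map (ι₀ j) =
      (singleFunctor A 0).map (ι₁ j) ≫ (singleFunctor A 0).map D := by
    rw [← Functor.map_comp, hD, Functor.map_comp]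
  have hι (j : J) : ∃ ι : P ⟶ Q, a ≫ ι = (singleFunctor A 0).map (ι₀ j) ≫ α ∧
      b ≫ ((singleFunctor A 0).map (ι₁ j))⟦(1 : ℤ)⟧' = ι ≫ β :=
    complete_distinguished_triangle_morphism _ _ hT hQ _ _ (comm₁ j)
  choose ι comm₂ comm₃ using hι
  have h₁ := isCoproductFamily_single.{w} fun _ : J => P₁
  have h₀ := isCoproductFamily_single.{w} fun _ : J => P₀
  have hι : IsCoproductFamily ι := IsCoproductFamily.of_distTriang hT hQ comm₁ comm₂ comm₃ h₁ h₀
  obtain ⟨π, hπ⟩ := hι.exists_projections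
  have hQ₀ : Q.IsLE 0 := isLE_of_twoTerm hQ
  -- Such a map lifts to `∐ P₀`, where smallness of `P₀` applies.
  have fin₀ (φ : (singleFunctor A 0).obj P₀ ⟶ Q) : IsFinitelySupported ι π φ := by
    obtain ⟨φ, rfl⟩ := exists_lift_mor₂ hQ φ
      (eq_zero_of_projective_of_isLE P₀ _ (isLE_single_shift _) _)
    obtain ⟨φ, rfl⟩ := (singleFunctor A 0).map_surjective φ
    induction φ using hP₀.hom_induction _ with
    | hι j g =>
      rw [Functor.map_comp, Category.assoc, ← comm₂, ← Category.assoc]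
      exact .comp_ι hπ j _
    | zero =>
      rw [Functor.map_zero, zero_comp]
      exact .zero
    | add f g hf hg =>
      rw [Functor.map_add, Preadditive.add_comp]
      exact hf.add hg
  obtain ⟨π₁, hπ₁⟩ : ∃ π₁ : J → (∐ (fun _ : J => P₁) ⟶ P₁),
      ∀ i j, ι₁ i ≫ π₁ j = if i = j then 𝟙 _ else 0 :=
    ⟨fun j => Sigma.desc fun i => if i = j then 𝟙 _ else 0, by simp [ι₁]⟩
  have comm₄ (j : J) : π j ≫ b = β ≫ ((singleFunctor A 0).map (π₁ j))⟦(1 : ℤ)⟧' :=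
    hι.hom_ext fun i => by
      rw [← reassoc_of% comm₃, ← Functor.map_comp, ← Functor.map_comp, hπ₁, reassoc_of% hπ]
      split_ifs
      · simp
      · simp
  have fin₁ (φ : P₁ ⟶ ∐ (fun _ : J => P₁)) : IsFinitelySupported ι₁ π₁ φ := by
    induction φ using hP₁.hom_induction _ with
    | hι j g => exact .comp_ι hπ₁ j _
    | zero => exact .zero
    | add f g hf hg => exact hf.add hg
  -- By degrees, `γ` is determined by `γ ≫ β`, a shifted map `P₁ ⟶ ∐ P₁`, to which `fin₁` applies.
  have fin₂ (γ : ((singleFunctor A 0).obj P₁)⟦(1 : ℤ)⟧ ⟶ Q) : IsFinitelySupported ι π γ := by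
    obtain ⟨γ', hγ'⟩ :=
      (singleFunctor A 0 ⋙ shiftFunctor (DerivedCategory A) (1 : ℤ)).map_surjective
      (γ ≫ β)
    obtain ⟨S, hS⟩ := fin₁ γ'
    refine ⟨S, fun S' h => ?_⟩
    obtain ⟨l, hl⟩ := exists_lift_mor₂ hQ (γ - ∑ j ∈ S', γ ≫ π j ≫ ι j) (by
      rw [Preadditive.sub_comp, sub_eq_zero, Preadditive.sum_comp, ← hγ']
      conv_lhs => rw [hS S' h]
      rw [Functor.map_sum]
      refine Finset.sum_congr rfl fun j _ => ?_
      rw [Category.assoc, Category.assoc, ← comm₃, reassoc_of% comm₄, ← reassoc_of% hγ',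
        Functor.map_comp, Functor.map_comp]
      rfl)
    have := isLE_single_shift.{w} P₁
    rw [t.zero l (-1) 0, zero_comp] at hl
    exact sub_eq_zero.1 hl
  have fin (φ : P ⟶ Q) : IsFinitelySupported ι π φ := by
    obtain ⟨S, hS⟩ := fin₀ (a ≫ φ)
    obtain ⟨γ, hγ⟩ := exists_desc_mor₃ hT (φ - ∑ j ∈ S, φ ≫ π j ≫ ι j) (by
      rw [Preadditive.comp_sub, sub_eq_zero, Preadditive.comp_sum]
      conv_lhs => rw [hS S subset_rfl]
      simp only [Category.assoc])
    rw [sub_eq_iff_eq_add] at hγ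
    rw [hγ]
    refine ((fin₂ γ).comp_left b).add ?_
    simp only [← Category.assoc]
    exact .sum hπ S _
  refine ⟨Q, ι, π, hι, hπ, fin, fun i hi => ?_⟩
  obtain rfl | hi : i = 1 ∨ 1 < i := by lia
  -- A map `P ⟶ Q[1]` comes from a map `P₁ ⟶ ∐ P₀`. On each summand it passes through a map `P ⟶
  -- P[1]`, which is zero.
  · intro f
    obtain ⟨γ, rfl⟩ := exists_desc_mor₃ hT f
      (homVanish_of_projective_of_isLE P₀ 0 1 hQ₀ (by lia) _)
    obtain ⟨γ, rfl⟩ := (shiftFunctor (DerivedCategory A) (1 : ℤ)).map_surjective γ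
    obtain ⟨γ, rfl⟩ := exists_lift_mor₂ hQ γ
      (eq_zero_of_projective_of_isLE P₁ _ (isLE_single_shift _) _)
    obtain ⟨γ, rfl⟩ := (singleFunctor A 0).map_surjective γ
    induction γ using hP₁.hom_induction _ with
    | hι j g =>
      have hg : (singleFunctor A 0).map (g ≫ ι₀ j) ≫ α =
          ((singleFunctor A 0).map g ≫ a) ≫ ι j := by
        rw [Functor.map_comp, Category.assoc, ← comm₂, ← Category.assoc]
      rw [hg, Functor.map_comp, ← Category.assoc, homVanish_self hT h_H0 (b ≫ _), zero_comp]
    | zero => simp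
    | add f g hf hg =>
      rw [Functor.map_add, Preadditive.add_comp, Functor.map_add, Preadditive.comp_add, hf, hg,
        add_zero]
  · exact homVanish_of_isLE hT 0 i hQ₀ (by lia)

variable [HasCoproducts.{v} A] (hP₁ : IsSmallObject P₁) (hP₀ : IsSmallObject P₀)
  (h_H0 : torsionPart P ((homologyFunctor A 0).obj P))
  (h_inter : ∀ X : A, torsionPart P X → torsionFreePart P X → IsZero X)
include hT hP₁ hP₀ h_H0 h_inter

/-- The objects of the heart which correspond to free modules. -/
lemma exists_free_object (J : Type v) :
    ∃ (M : DerivedCategory A) (ι : J → (P ⟶ M)), heart P M ∧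
      (∀ Y, heart P Y → ∀ g : J → (P ⟶ Y), ∃ f : M ⟶ Y, ∀ j, ι j ≫ f = g j) ∧
      (∀ Y, heart P Y → ∀ f : M ⟶ Y, (∀ j, ι j ≫ f = 0) → f = 0) ∧
      (∀ φ : P ⟶ M, ∃ (S : Finset J) (c : J → (P ⟶ P)), φ = ∑ j ∈ S, c j ≫ ι j) ∧
      ∀ (S : Finset J) (c : J → (P ⟶ P)), ∑ j ∈ S, c j ≫ ι j = 0 → ∀ j ∈ S, c j = 0 := by
  classical
  obtain ⟨Q, ι, π, hι, hπ, fin, hQ⟩ := exists_coproduct_twoTerm hT hP₁ hP₀ h_H0 J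
  obtain ⟨U, M, i, p, k, h, hU, hM⟩ := exists_triangle_homLE_homGE hT hP₁ h_H0 Q
  have orth {Y : DerivedCategory A} (hY : homGE P 0 Y) (n : ℤ) (hn : n < 0) : HomVanish U Y n :=
    hom_eq_zero_of_homLE_of_homGE hT hP₁ h_H0 h_inter hU (homGE_shift hY n 1 (by lia))
  -- Replacing `Q` by its truncation `M` changes neither `Hom(P, -)`, as `Hom(P, U[1]) = Hom(P,
  -- U[2]) = 0`, nor maps to an object `Y` of the heart, as `Hom(U[1], Y) = Hom(U[2], Y) = 0`.
  refine ⟨M, fun j => ι j ≫ p, ⟨homLE_mor₃ h hQ (homLE_shift hU 1 1 (by lia)), hM⟩,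
    fun Y hY g => ?_, fun Y hY f hf => ?_, fun φ => ?_, fun S c hc j hj => ?_⟩
  · obtain ⟨f, hf⟩ := (hι Y).1 g
    obtain ⟨f', rfl⟩ := exists_desc_mor₂ h f
      ((eq_zero_shift_iff 1 (-1) (by lia)).2 (orth hY.2 _ (by lia)) _)
    exact ⟨f', fun j => by rw [Category.assoc, hf]⟩
  · obtain ⟨l, rfl⟩ := exists_desc_mor₃ h f ((hι Y).2 _ fun j => by rw [← Category.assoc, hf])
    rw [(eq_zero_shift_iff 1 (-1) (by lia)).2 ((eq_zero_shift_iff 1 (-1) (by lia)).2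
      ((homVanish_shift_iff (-1) (-1) (-2) (by lia)).2 (orth hY.2 _ (by lia)))) l, comp_zero]
  · obtain ⟨φ, rfl⟩ := exists_lift_mor₂ h φ
      ((homVanish_shift_iff 1 1 2 (by lia)).2 (hU 2 (by lia)) _)
    obtain ⟨S, hS⟩ := fin φ
    refine ⟨S, fun j => φ ≫ π j, ?_⟩
    conv_lhs => rw [hS S subset_rfl]
    simp only [Preadditive.sum_comp, Category.assoc]
  · simp only [← Category.assoc] at hc
    rw [← Preadditive.sum_comp] at hc
    obtain ⟨l, hl⟩ := exists_lift_mor₁ h _ hc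
    rw [hU 1 (by lia) l, zero_comp] at hl
    have := hl =≫ π j
    simp only [Preadditive.sum_comp, Category.assoc, hπ, zero_comp] at this
    rw [Finset.sum_eq_single_of_mem j hj, if_pos rfl, Category.comp_id] at this
    · exact this
    · intro i _ hi
      rw [if_neg hi, comp_zero]

end FreeObjects

/-! ### Bases of the modules `Hom(P, M)`. -/

section FreeModules

variable {T : Type u} [Category.{w} T] [Preadditive T] {J : Type v} {P M : T} {ι : J → (P ⟶ M)}

lemma span_range_eq_top
    (hι : ∀ φ : P ⟶ M, ∃ (S : Finset J) (c : J → (P ⟶ P)), φ = ∑ j ∈ S, c j ≫ ι j) :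
    Submodule.span (End P)ᵐᵒᵖ (Set.range ι) = ⊤ := by
  refine eq_top_iff.2 fun φ _ => ?_
  obtain ⟨S, c, rfl⟩ := hι φ
  exact Submodule.sum_mem _ fun j _ =>
    Submodule.smul_mem _ (MulOpposite.op (show End P from c j))
      (Submodule.subset_span (Set.mem_range_self j))

lemma exists_linearMap_of_free
    (hι : ∀ φ : P ⟶ M, ∃ (S : Finset J) (c : J → (P ⟶ P)), φ = ∑ j ∈ S, c j ≫ ι j)
    (hι' : ∀ (S : Finset J) (c : J → (P ⟶ P)), ∑ j ∈ S, c j ≫ ι j = 0 → ∀ j ∈ S, c j = 0)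
    {N : Type*} [AddCommGroup N] [Module (End P)ᵐᵒᵖ N] (n : J → N) :
    ∃ l : (P ⟶ M) →ₗ[(End P)ᵐᵒᵖ] N, ∀ j, l (ι j) = n j := by
  have hli : LinearIndependent (End P)ᵐᵒᵖ ι := by
    rw [linearIndependent_iff']
    intro S c hc j hj
    exact MulOpposite.unop_injective (hι' S (fun j => (c j).unop) hc j hj)
  let B := Module.Basis.mk hli (span_range_eq_top hι).ge
  refine ⟨B.constr ℕ n, fun j => ?_⟩
  have := B.constr_basis ℕ n j
  rwa [Module.Basis.mk_apply] at this

end FreeModules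

/-! ### The equivalence between the heart and modules. -/

section Equivalence

variable {A : Type u} [Category.{v} A] [Abelian A] [HasDerivedCategory.{w} A]

lemma small_hom_of_projective (Q : A) [Projective Q] (V : DerivedCategory A) :
    Small.{v} ((singleFunctor A 0).obj Q ⟶ V) := by
  obtain ⟨Y, e, -⟩ := exists_equiv_of_projective V
  exact small_map (e Q)

variable {P₁ P₀ : A} [Projective P₁] [Projective P₀] {d : P₁ ⟶ P₀} {P : DerivedCategory A}
  {a : (singleFunctor A 0).obj P₀ ⟶ P} {b : P ⟶ ((singleFunctor A 0).obj P₁)⟦(1 : ℤ)⟧}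
  (hT : Triangle.mk ((singleFunctor A 0).map d) a b ∈ distTriang (DerivedCategory A))

include hT in
lemma small_hom (V : DerivedCategory A) : Small.{v} (P ⟶ V) := by
  classical
  have h₀ := small_hom_of_projective P₀ V
  have h₁ := small_hom_of_projective P₁ (V⟦(-1 : ℤ)⟧)
  let e : V⟦(-1 : ℤ)⟧⟦(1 : ℤ)⟧ ≅ V :=
    (shiftEquiv (DerivedCategory A) (1 : ℤ)).counitIso.app V
  -- A set-theoretic section of composition with `a`; its value `0` off the image plays no role.
  let s (u : (singleFunctor A 0).obj P₀ ⟶ V) : P ⟶ V :=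
    if h : ∃ f, a ≫ f = u then h.choose else 0
  refine small_of_surjective (f := fun x : ((singleFunctor A 0).obj P₀ ⟶ V) ×
    ((singleFunctor A 0).obj P₁ ⟶ V⟦(-1 : ℤ)⟧) => s x.1 + b ≫ x.2⟦(1 : ℤ)⟧' ≫ e.hom) fun f => ?_
  have hs : a ≫ s (a ≫ f) = a ≫ f := by
    have h : ∃ f', a ≫ f' = a ≫ f := ⟨f, rfl⟩
    simp only [s, dif_pos h]
    exact h.choose_spec
  obtain ⟨l, hl⟩ := exists_desc_mor₃ hT (f - s (a ≫ f)) (by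
    rw [Preadditive.comp_sub, hs, sub_self])
  obtain ⟨l', hl'⟩ := (shiftFunctor (DerivedCategory A) (1 : ℤ)).map_surjective (l ≫ e.inv)
  refine ⟨⟨a ≫ f, l'⟩, ?_⟩
  dsimp only
  rw [hl', Category.assoc, e.inv_hom_id, Category.comp_id, ← hl, add_sub_cancel]

omit [Projective P₁] [Projective P₀] in
/-- The fiber of a morphism of the heart which is surjective on `Hom (P, -)` is in the heart. -/
lemma exists_fiber {X M : DerivedCategory A} (hX : heart P X) (hM : heart P M) (p : M ⟶ X)
    (hp : ∀ φ : P ⟶ X, ∃ ψ : P ⟶ M, φ = ψ ≫ p) :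
    ∃ (K : DerivedCategory A) (i : K ⟶ M) (k : X ⟶ K⟦(1 : ℤ)⟧),
      Triangle.mk i p k ∈ distTriang (DerivedCategory A) ∧ heart P K := by
  obtain ⟨K, i, k, h⟩ := distinguished_cocone_triangle₁ p
  -- This is where surjectivity enters: `Hom(P, K[1])` is the cokernel of `Hom(P, M) ⟶ Hom(P, X)`.
  have h₁ : HomVanish P K 1 := fun f => by
    obtain ⟨φ, rfl⟩ := exists_lift_mor₂ (rot_of_distTriang _ h) f (hM.1 1 (by lia) _)
    obtain ⟨ψ, rfl⟩ := hp φ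
    have : p ≫ k = 0 := mor₂_comp_mor₃ h
    exact (Category.assoc _ _ _).trans ((congrArg (ψ ≫ ·) this).trans comp_zero)
  refine ⟨K, i, k, h, fun n hn => ?_, fun n hn => ?_⟩
  · obtain rfl | hn : n = 1 ∨ 1 < n := by lia
    · exact h₁
    · exact homVanish_mor₁ h (n - 1) n (by lia) (hX.1 _ (by lia)) (hM.1 _ (by lia))
  · exact homVanish_mor₁ h (n - 1) n (by lia) (hX.2 _ (by lia)) (hM.2 _ (by lia))

variable [HasCoproducts.{v} A] (hP₁ : IsSmallObject P₁) (hP₀ : IsSmallObject P₀)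
  (h_H0 : torsionPart P ((homologyFunctor A 0).obj P))
  (h_inter : ∀ X : A, torsionPart P X → torsionFreePart P X → IsZero X)
include hT hP₁ hP₀ h_H0 h_inter

/-- The free object on all of `Hom(P, X)` maps to `X` with fibre `K` in the heart. The map `f`
vanishes on it, so it factors through `K[1]`, and `Hom(K[1], Y) = 0`. -/
lemma eq_zero_of_forall_comp_eq_zero {X Y : DerivedCategory A} (hX : heart P X) (hY : heart P Y)
    (f : X ⟶ Y) (hf : ∀ φ : P ⟶ X, φ ≫ f = 0) : f = 0 := by
  have := small_hom hT X
  obtain ⟨M, ι, hM, hM₁, hM₂, -⟩ :=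
    exists_free_object hT hP₁ hP₀ h_H0 h_inter (Shrink.{v} (P ⟶ X))
  obtain ⟨p, hp⟩ := hM₁ X hX fun j => (equivShrink _).symm j
  obtain ⟨K, i, k, h, hK⟩ := exists_fiber hX hM p fun φ => ⟨ι (equivShrink _ φ), by simp [hp]⟩
  obtain ⟨l, rfl⟩ := exists_desc_mor₃ h f
    (hM₂ Y hY _ fun j => by rw [← Category.assoc]; exact hf _)
  rw [(eq_zero_shift_iff 1 (-1) (by lia)).2 (hom_eq_zero_of_homLE_of_homGE hT hP₁ h_H0 h_inter
    hK.1 (homGE_shift hY.2 (-1) 1 (by lia))) l, comp_zero]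

lemma exists_comp_eq {X Y : DerivedCategory A} (hX : heart P X) (hY : heart P Y)
    (g : (P ⟶ X) →ₗ[(End P)ᵐᵒᵖ] (P ⟶ Y)) : ∃ f : X ⟶ Y, ∀ φ, φ ≫ f = g φ := by
  have := small_hom hT X
  obtain ⟨M, ι, hM, hM₁, -, hM₃, -⟩ :=
    exists_free_object hT hP₁ hP₀ h_H0 h_inter (Shrink.{v} (P ⟶ X))
  obtain ⟨p, hp⟩ := hM₁ X hX fun j => (equivShrink _).symm j
  have hp' (φ : P ⟶ X) : ∃ ψ : P ⟶ M, φ = ψ ≫ p := ⟨ι (equivShrink _ φ), by simp [hp]⟩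
  obtain ⟨K, i, k, h, hK⟩ := exists_fiber hX hM p hp'
  obtain ⟨q, hq⟩ := hM₁ Y hY fun j => g (ι j ≫ p)
  have hq' (φ : P ⟶ M) : φ ≫ q = g (φ ≫ p) := by
    obtain ⟨S, c, rfl⟩ := hM₃ φ
    rw [Preadditive.sum_comp, Preadditive.sum_comp, map_sum]
    refine Finset.sum_congr rfl fun j _ => ?_
    rw [Category.assoc, Category.assoc, hq]
    exact (g.map_smul (MulOpposite.op (show End P from c j)) (ι j ≫ p)).symm
  -- The map `q` realizes `g` on the free cover. It kills the fibre `K` by faithfulness, so it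
  -- descends to `X`.
  obtain ⟨f, rfl⟩ := exists_desc_mor₂ h q
    (eq_zero_of_forall_comp_eq_zero hT hP₁ hP₀ h_H0 h_inter hK hY _ fun φ => by
      rw [← Category.assoc, hq', Category.assoc, mor₁_comp_mor₂ h, comp_zero, map_zero])
  refine ⟨f, fun φ => ?_⟩
  obtain ⟨ψ, rfl⟩ := hp' φ
  rw [Category.assoc, hq']

/-- A free presentation of `N` is realized by `f : M' ⟶ M` in the heart. `Q` is the cokernel of `f`,
and `Hom(P, -)` preserves it because `Hom(P, K[1])`, `Hom(P, K[2])` and `Hom(P, M'[1])` vanish. -/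
lemma exists_linearEquiv (N : Type w) [AddCommGroup N] [Module (End P)ᵐᵒᵖ N] [Small.{v} N] :
    ∃ Q : DerivedCategory A, heart P Q ∧ Nonempty ((P ⟶ Q) ≃ₗ[(End P)ᵐᵒᵖ] N) := by
  obtain ⟨M, ι, hM, -, -, hM₃, hM₄⟩ :=
    exists_free_object hT hP₁ hP₀ h_H0 h_inter (Shrink.{v} N)
  obtain ⟨r, hr⟩ := exists_linearMap_of_free hM₃ hM₄ fun j => (equivShrink N).symm j
  have hr' : Function.Surjective r := fun n => ⟨ι (equivShrink N n), by simp [hr]⟩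
  have := small_hom hT M
  obtain ⟨M', ι', hM', hM₁', -, hM₃', -⟩ :=
    exists_free_object hT hP₁ hP₀ h_H0 h_inter (Shrink.{v} (LinearMap.ker r))
  obtain ⟨f, hf⟩ := hM₁' M hM fun j => ((equivShrink (LinearMap.ker r)).symm j).1
  have hf' (φ : P ⟶ M) : (∃ χ, φ = χ ≫ f) ↔ r φ = 0 := by
    constructor
    · rintro ⟨χ, rfl⟩
      obtain ⟨S, c, rfl⟩ := hM₃' χ
      rw [Preadditive.sum_comp, map_sum]
      refine Finset.sum_eq_zero fun j _ => ?_
      rw [Category.assoc, hf]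
      refine (r.map_smul (MulOpposite.op (show End P from c j)) _).trans ?_
      rw [((equivShrink (LinearMap.ker r)).symm j).2, smul_zero]
    · intro hφ
      exact ⟨ι' (equivShrink _ ⟨φ, hφ⟩), by simp [hf]⟩
  obtain ⟨Z, g, k, h⟩ := distinguished_cocone_triangle f
  obtain ⟨K, Q, i, p, l, h'⟩ := (isAdmissibleAbelian_heart hT hP₁ h_H0 h_inter).admissible
    (X := ⟨M', hM'⟩) (Y := ⟨M, hM⟩) (ObjectProperty.homMk f) g k h
  let q : (P ⟶ M) →ₗ[(End P)ᵐᵒᵖ] (P ⟶ Q.obj) :=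
    ((preadditiveCoyonedaObj P).map (g ≫ p)).hom
  have hq (φ : P ⟶ M) : q φ = φ ≫ g ≫ p := rfl
  have hq' : Function.Surjective q := fun φ => by
    obtain ⟨φ', rfl⟩ := exists_lift_mor₂ h' φ
      ((homVanish_shift_iff 1 1 2 (by lia)).2 (K.2.1 2 (by lia)) _)
    obtain ⟨ψ, rfl⟩ := exists_lift_mor₂ h φ' (hM'.1 1 (by lia) _)
    exact ⟨ψ, (Category.assoc _ _ _).symm⟩
  have hker : LinearMap.ker q = LinearMap.ker r := by
    ext φ
    rw [LinearMap.mem_ker, LinearMap.mem_ker, ← hf', hq]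
    constructor
    · intro hφ
      obtain ⟨m, hm⟩ := exists_lift_mor₁ h' (φ ≫ g) ((Category.assoc _ _ _).trans hφ)
      rw [K.2.1 1 (by lia) m, zero_comp] at hm
      exact exists_lift_mor₁ h φ hm
    · rintro ⟨χ, rfl⟩
      rw [Category.assoc, reassoc_of% (mor₁_comp_mor₂ h), zero_comp, comp_zero]
  exact ⟨Q.obj, Q.2, ⟨(q.quotKerEquivOfSurjective hq').symm ≪≫ₗ
    Submodule.quotEquivOfEq _ _ hker ≪≫ₗ r.quotKerEquivOfSurjective hr'⟩⟩

theorem isEquivalence_homFunctor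
    (h_set : ∀ X, setModules.{w, v} (End P)ᵐᵒᵖ ((homFunctor P (heart P)).obj X)) :
    ((setModules.{w, v} (End P)ᵐᵒᵖ).lift (homFunctor P (heart P)) h_set).IsEquivalence where
  faithful := ⟨fun {X Y f g} hfg => by
    refine (heart P).ι.map_injective (sub_eq_zero.1
      (eq_zero_of_forall_comp_eq_zero hT hP₁ hP₀ h_H0 h_inter X.2 Y.2 _ fun φ => ?_))
    rw [Preadditive.comp_sub, sub_eq_zero]
    exact congrArg (fun m => m.hom.hom φ) hfg⟩
  full := ⟨fun {X Y} g => by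
    obtain ⟨f, hf⟩ := exists_comp_eq hT hP₁ hP₀ h_H0 h_inter X.2 Y.2 g.hom.hom
    exact ⟨ObjectProperty.homMk f, by ext φ; exact hf φ⟩⟩
  essSurj := ⟨fun N => by
    have : Small.{v} N.obj := N.2
    obtain ⟨Q, hQ, ⟨e⟩⟩ := exists_linearEquiv hT hP₁ hP₀ h_H0 h_inter N.obj
    exact ⟨⟨Q, hQ⟩, ⟨(setModules.{w, v} (End P)ᵐᵒᵖ).isoMk e.toModuleIso⟩⟩⟩

end Equivalence

end TwoTermHeart

theorem theorem2p15 {A : Type u} [Category.{v} A] [Abelian A]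
    [HasCoproducts.{v} A] [AB4OfSize.{v} A] [HasDerivedCategory.{w} A]
    {P₁ P₀ : A} (d : P₁ ⟶ P₀) [Projective P₁] [Projective P₀]
    (hP₁ : TwoTermHeart.IsSmallObject P₁) (hP₀ : TwoTermHeart.IsSmallObject P₀)
    (P : DerivedCategory.{w} A) (hP : P = TwoTermHeart.twoTerm.{w} d)
    (h_inter : ∀ X : A, TwoTermHeart.torsionPart P X → TwoTermHeart.torsionFreePart P X →
      IsZero X)
    (h_H0 : TwoTermHeart.torsionPart P ((DerivedCategory.homologyFunctor A 0).obj P)) :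
    ∃ h : TwoTermHeart.IsAdmissibleAbelian (TwoTermHeart.heart P),
      (∃ h_set : ∀ X, TwoTermHeart.setModules.{w, v} (End P)ᵐᵒᵖ
          ((TwoTermHeart.homFunctor P (TwoTermHeart.heart P)).obj X),
        ((TwoTermHeart.setModules.{w, v} (End P)ᵐᵒᵖ).lift
          (TwoTermHeart.homFunctor P (TwoTermHeart.heart P)) h_set).IsEquivalence) ∧
      TwoTermHeart.inDegreeZeroShift (TwoTermHeart.torsionFreePart P) ≤ TwoTermHeart.heart P ∧
      TwoTermHeart.inDegreeZero (TwoTermHeart.torsionPart P) ≤ TwoTermHeart.heart P ∧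
      letI : Abelian (TwoTermHeart.heart P).FullSubcategory := h.abelian
      TwoTermHeart.IsTorsionTheory
        ((TwoTermHeart.inDegreeZeroShift (TwoTermHeart.torsionFreePart P)).inverseImage
          (TwoTermHeart.heart P).ι)
        ((TwoTermHeart.inDegreeZero (TwoTermHeart.torsionPart P)).inverseImage
          (TwoTermHeart.heart P).ι) := by
  obtain ⟨a, b, hT⟩ : ∃ (a : (DerivedCategory.singleFunctor A 0).obj P₀ ⟶ P)
      (b : P ⟶ ((DerivedCategory.singleFunctor A 0).obj P₁)⟦(1 : ℤ)⟧),
      Triangle.mk ((DerivedCategory.singleFunctor A 0).map d) a b ∈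
        distTriang (DerivedCategory A) := by
    subst hP
    exact ⟨_, _, DerivedCategory.mappingCone_triangle_distinguished
      ((CochainComplex.singleFunctor A 0).map d)⟩
  have h := TwoTermHeart.isAdmissibleAbelian_heart hT hP₁ h_H0 h_inter
  have h_set (X) : TwoTermHeart.setModules.{w, v} (End P)ᵐᵒᵖ
      ((TwoTermHeart.homFunctor P (TwoTermHeart.heart P)).obj X) :=
    TwoTermHeart.small_hom hT X.obj
  exact ⟨h, ⟨h_set, TwoTermHeart.isEquivalence_homFunctor hT hP₁ hP₀ h_H0 h_inter h_set⟩,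
    TwoTermHeart.inDegreeZeroShift_le_heart hT, TwoTermHeart.inDegreeZero_le_heart hT,
    TwoTermHeart.isTorsionTheory_heart hT hP₁ h_H0 h_inter h⟩
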